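/- **Setting.** Fix $K\ge 1$ channels, and let $\mathcal P(K)$ be the set of non-empty subsets of $\{1,\dots,K\}$ (the user classes). Let $\varepsilon>0$ and $m\ge 1$, and let $\mathcal D$ be the flat square torus of side $m\varepsilon$, tessellated into $N_\varepsilon=m^2$ square cells of side $\varepsilon$ with centers $a_i$, the origin being one of the centers. Let $\lambda>0$, let $(p_C)_{C\in\mathcal P(K)}$ be a probability distribution, let $L_C>0$ and $\mathcal N_0>0$, and let $\ell:[0,\infty)\to[0,\infty)$ be non-increasing with $\ell(0)=1$. Put $\mathcal V_i=\{b\in\mathcal D:\|b-a_i\|\in\{0,\varepsilon\}\}$ and $$\ell^\varepsilon(a_i,a_j)=\max\{\ell(\|b_i-b_j\|): b_i\in\mathcal V_i,\ b_j\in\mathcal V_j\}.$$ For $x\in\mathbb N^{N_\varepsilon\times(2^K-1)}$ let $$\bar R_{i,C}(x)=\frac{|C|}{\mathcal N_0+\sum_{k,U}|C\cap U|\,\ell^\varepsilon(a_k,a_i)\,\bigl(x_{k,U}-\mathbf 1_{\{U=C,\,k=i\}}\bigr)} .$$ Let $(\mathcal A_{i,C})$ and $(N_{i,C})$ be independent Poisson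 processes of intensity $1$ on one probability space $(\Omega,\mathcal F,\mathbb P)$. For each $n$ let $\bar{\mathbf X}^n$ be a càdlàg process with values in $\mathbb N^{N_\varepsilon\times(2^K-1)}$ (the discretized dominating chain $\bar{\mathbf X}_\varepsilon$ with initial state $\bar{\mathbf X}^n(0)$) such that almost surely, for all $t\ge 0$ and all $i,C$, $$\bar X^n_{i,C}(t)=\bar X^n_{i,C}(0)+\mathcal A_{i,C}(\lambda p_C\varepsilon^2t)-N_{i,C}\Bigl(\frac1{L_C}\int_0^t\bar X^n_{i,C}(u)\,\bar R_{i,C}(\bar{\mathbf X}^n(u))\,\mathrm du\Bigr).$$ **Theorem.** Let $\bar{\mathbf x}_0\neq 0$ be a deterministic vector such that, for all $i$ and $C$, $\bar x_{0,i,C}>0$ or $p_C>0$ (in particular, $\bar{\mathbf x}_0$ may be any vector with strictly positive coordinates, or any non-zero vector in $[0,\infty)^{N_\varepsilon\times(2^K-1)}$ if all $p_C$ are positive). Suppose that $\frac1n\bar{\mathbf X}^n(0)\to\bar{\mathbf x}_0$ almost surely. Then there is exactly one continuous function $\bar{\mathbf x}:[0,\infty)\to[0,\infty)^{N_\varepsilon\times(2^K-1)}$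 with $\bar{\mathbf x}(0)=\bar{\mathbf x}_0$ such that, at every $t>0$ with $\bar{\mathbf x}(t)\ne 0$ and for all $i,C$, the denominator below is positive, $\bar x_{i,C}$ is differentiable at $t$, and $$\bar x_{i,C}'(t)=\lambda p_C\varepsilon^2-\frac1{L_C}\,\frac{|C|\,\bar x_{i,C}(t)}{\sum_{k,U}|C\cap U|\,\ell^\varepsilon(a_k,a_i)\,\bar x_{k,U}(t)} .$$ Moreover, $\mathbb P$-almost surely, for every $T>0$, $$\lim_{n\to\infty}\ \sup_{0\le t\le T}\Bigl\|\tfrac1n\bar{\mathbf X}^n(nt)-\bar{\mathbf x}(t)\Bigr\|=0 .$$ -/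

import Mathlib

open MeasureTheory ProbabilityTheory Filter Topology
open scoped NNReal

noncomputable section

/-! ### The discretized torus -/

/-- The square torus of side `S`. -/
abbrev SquareTorus (S : ℝ) : Type := AddCircle S × AddCircle S

/-- The Euclidean (flat) distance on the square torus; the norm on `AddCircle S` is the
distance to `0` on the circle of length `S`. -/
def torusDist {S : ℝ} (x y : SquareTorus S) : ℝ :=
  √(‖x.1 - y.1‖ ^ 2 + ‖x.2 - y.2‖ ^ 2)

/-- Indices of the `m * m` square cells of side `ε` that tessellate the torus of side `m * ε`. -/
abbrev Cell (m : ℕ) : Type := Fin m × Fin m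

/-- The center of a cell. The cell `(0, 0)` is centered at the origin. -/
def cellCenter (ε : ℝ) (m : ℕ) (i : Cell m) : SquareTorus ((m : ℝ) * ε) :=
  (((((i.1 : ℕ) : ℝ) * ε : ℝ) : AddCircle ((m : ℝ) * ε)),
    ((((i.2 : ℕ) : ℝ) * ε : ℝ) : AddCircle ((m : ℝ) * ε)))

/-- The points at distance `0` or `ε` from the center of the cell `i`. -/
def vicinity (ε : ℝ) (m : ℕ) (i : Cell m) : Set (SquareTorus ((m : ℝ) * ε)) :=
  {b | torusDist b (cellCenter ε m i) = 0 ∨ torusDist b (cellCenter ε m i) = ε}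

/-- The user classes: non-empty sets of channels among `K` channels. -/
abbrev UserClass (K : ℕ) : Type := {C : Finset (Fin K) // C.Nonempty}

/-! ### The network and its dominating chain -/

/-- The parameters of the network with `K` channels on the torus of side `m * ε`,
discretized into `m * m` cells of side `ε` (the links have length `0`). -/
structure Network (K m : ℕ) where
  /-- side length of the cells -/
  ε : ℝ
  /-- arrival intensity -/
  lam : ℝ
  /-- distribution of the class of an arriving user -/
  p : UserClass K → ℝ
  /-- mean file size of each class -/
  L : UserClass K → ℝ
  /-- thermal noise -/
  noise : ℝ
  /-- path-loss function; only its values on `[0, ∞)` are used -/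
  pathLoss : ℝ → ℝ
  m_pos : 0 < m
  ε_pos : 0 < ε
  lam_pos : 0 < lam
  p_nonneg : ∀ C, 0 ≤ p C
  p_sum : ∑ C, p C = 1
  L_pos : ∀ C, 0 < L C
  noise_pos : 0 < noise
  pathLoss_nonneg : ∀ r, 0 ≤ r → 0 ≤ pathLoss r
  pathLoss_antitone : AntitoneOn pathLoss (Set.Ici 0)
  pathLoss_zero : pathLoss 0 = 1

namespace Network

variable {K m : ℕ}

/-- The upper path-loss between the cells `i` and `j`: the maximum of the path-loss over pairs of
points of the two vicinities. -/
def upperPathLoss (M : Network K m) (i j : Cell m) : ℝ :=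
  sSup {v | ∃ b ∈ vicinity M.ε m i, ∃ c ∈ vicinity M.ε m j, v = M.pathLoss (torusDist b c)}

/-- The interference seen by a user of class `C` in cell `i` in the state `x`, the user itself
being left out. -/
def interference (M : Network K m) (x : Cell m → UserClass K → ℕ) (i : Cell m)
    (C : UserClass K) : ℝ :=
  ∑ k, ∑ U : UserClass K, ((C.1 ∩ U.1).card : ℝ) * M.upperPathLoss k i *
    ((x k U : ℝ) - if U = C ∧ i = k then 1 else 0)

/-- The rate of transmission of a user of class `C` in cell `i` in the state `x`. -/
def transmissionRate (M : Network K m) (x : Cell m → UserClass K → ℕ) (i : Cell m)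
    (C : UserClass K) : ℝ :=
  (C.1.card : ℝ) / (M.noise + M.interference x i C)

/-- `ξ` is a càdlàg path of the dominating chain, when the arrivals are driven by the
paths `a i C` and the departures by the paths `d i C`. -/
structure IsDominatingPath (M : Network K m) (a d : Cell m → UserClass K → ℝ≥0 → ℕ)
    (ξ : ℝ → Cell m → UserClass K → ℕ) : Prop where
  rightContinuous : ∀ t, 0 ≤ t → ContinuousWithinAt ξ (Set.Ici t) t
  leftLimit : ∀ t, 0 < t → ∃ l, Tendsto ξ (𝓝[<] t) (𝓝 l)
  dynamics : ∀ t, 0 ≤ t → ∀ i C,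
    (ξ t i C : ℝ) = (ξ 0 i C : ℝ) + (a i C (Real.toNNReal (M.lam * M.p C * M.ε ^ 2 * t)) : ℝ)
      - (d i C (Real.toNNReal
          (1 / M.L C * ∫ u in (0 : ℝ)..t, (ξ u i C : ℝ) * M.transmissionRate (ξ u) i C)) : ℝ)

/-- The fluid interference seen by class `C` in cell `i` in the fluid state `x`. -/
def fluidInterference (M : Network K m) (x : Cell m → UserClass K → ℝ) (i : Cell m)
    (C : UserClass K) : ℝ :=
  ∑ k, ∑ U : UserClass K, ((C.1 ∩ U.1).card : ℝ) * M.upperPathLoss k i * x k U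

/-- `x : [0, ∞) → [0, ∞)^(cells × classes)` is a solution of the fluid equations started
from `x₀`: it is continuous, and at each positive time at which `x` is not the zero vector, the
right-hand sides of the equations are well defined (the denominators are positive) and the
equations hold. -/
structure IsFluidSolution (M : Network K m) (x₀ : Cell m → UserClass K → ℝ)
    (x : ℝ → Cell m → UserClass K → ℝ) : Prop where
  continuousOn : ContinuousOn x (Set.Ici 0)
  nonneg : ∀ t, 0 ≤ t → ∀ i C, 0 ≤ x t i C
  initial : x 0 = x₀
  denominator_pos : ∀ t, 0 < t → x t ≠ 0 → ∀ i C, 0 < M.fluidInterference (x t) i C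
  ode : ∀ t, 0 < t → x t ≠ 0 → ∀ i C,
    HasDerivAt (fun s => x s i C)
      (M.lam * M.p C * M.ε ^ 2
        - 1 / M.L C * ((C.1.card : ℝ) * x t i C / M.fluidInterference (x t) i C)) t

end Network

/-! ### Poisson processes -/

/-- `Z` is a Poisson process of intensity `1`: a counting process started from `0`
with independent increments, such that `Z t - Z s` has the Poisson law of mean `t - s`. -/
structure IsUnitPoissonProcess {Ω : Type*} [MeasurableSpace Ω] (Z : ℝ≥0 → Ω → ℕ)
    (P : Measure Ω) : Prop where
  measurable : ∀ t, Measurable (Z t)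
  zero : ∀ ω, Z 0 ω = 0
  monotone : ∀ ω, Monotone fun t => Z t ω
  rightContinuous : ∀ ω t, ContinuousWithinAt (fun s => Z s ω) (Set.Ici t) t
  indepIncrements : HasIndepIncrements Z P
  law : ∀ s t, s ≤ t → P.map (fun ω => Z t ω - Z s ω) = poissonMeasure (t - s)

end

/-! Under the scaling by `n`, the noise and the exclusion of a user from its own interference
disappear, and the departure rate becomes homogeneous of degree 0 in the state. Hence `c * x (s + t
/ c)` solves the fluid equations whenever `x` does (`rescale`). The departure rate of a coordinate
is also nonincreasing in the other coordinates, so solutions obey a comparison principle, although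
the vector field is singular at 0.

Uniqueness rests on these two facts. `le_of_pos` compares a solution with positive coordinates to
any solution that starts below it. `pos_of_ne_zero` gives positivity until 0 is reached.
`le_of_ne_zero` uses rescaling to allow initial coordinates equal to 0. Rescaling also shows that 0
is absorbing (`eq_zero_of_initial_zero`).

Existence and convergence come from compactness. The law of large numbers for the Poisson processes
makes the rescaled paths asymptotically Lipschitz, so they converge along every ultrafilter, and
each limit is a weak solution (`isWeakFluidSolution_of_tendsto`). The weak notion asks for the
equation of a coordinate only where its interference is positive, which is what passes to the limit
directly; `isFluidSolution` recovers the full notion. One good sample path yields existence, and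
uniqueness identifies all the limits. -/

namespace Network

variable {K m : ℕ}

/-! ### Geometry of the cells -/

lemma torusDist_self {S : ℝ} (x : SquareTorus S) : torusDist x x = 0 := by
  simp [torusDist]

lemma upperPathLoss_nonneg (M : Network K m) (i j : Cell m) : 0 ≤ M.upperPathLoss i j := by
  refine Real.sSup_nonneg ?_
  rintro v ⟨b, -, c, -, rfl⟩
  exact M.pathLoss_nonneg _ (Real.sqrt_nonneg _)

/-- A common point realizes distance 0, where the path-loss has its largest value. -/
lemma upperPathLoss_eq_one (M : Network K m) {i j : Cell m} (b : SquareTorus ((m : ℝ) * M.ε))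
    (hi : b ∈ vicinity M.ε m i) (hj : b ∈ vicinity M.ε m j) : M.upperPathLoss i j = 1 := by
  have hle : ∀ v ∈ {v | ∃ b ∈ vicinity M.ε m i, ∃ c ∈ vicinity M.ε m j,
      v = M.pathLoss (torusDist b c)}, v ≤ 1 := by
    rintro v ⟨b, -, c, -, rfl⟩
    rw [← M.pathLoss_zero]
    have h : 0 ≤ torusDist b c := Real.sqrt_nonneg _
    exact M.pathLoss_antitone (Set.mem_Ici.2 le_rfl) (Set.mem_Ici.2 h) h
  have hmem : (1 : ℝ) ∈ {v | ∃ b ∈ vicinity M.ε m i, ∃ c ∈ vicinity M.ε m j,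
      v = M.pathLoss (torusDist b c)} :=
    ⟨b, hi, b, hj, by rw [torusDist_self, M.pathLoss_zero]⟩
  exact le_antisymm (csSup_le ⟨1, hmem⟩ hle) (le_csSup ⟨1, hle⟩ hmem)

lemma cellCenter_mem_vicinity (M : Network K m) (i : Cell m) :
    cellCenter M.ε m i ∈ vicinity M.ε m i := Or.inl (torusDist_self _)

lemma upperPathLoss_self (M : Network K m) (i : Cell m) : M.upperPathLoss i i = 1 :=
  M.upperPathLoss_eq_one _ (M.cellCenter_mem_vicinity i) (M.cellCenter_mem_vicinity i)

lemma norm_coe_eps (M : Network K m) (hm : 2 ≤ m) (x : ℝ) (hx : |x| = M.ε) :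
    ‖(x : AddCircle ((m : ℝ) * M.ε))‖ = M.ε := by
  have hε := M.ε_pos
  have hm' : (2 : ℝ) ≤ m := by exact_mod_cast hm
  have hp : 0 < (m : ℝ) * M.ε := by positivity
  -- Since `2 ≤ m`, the length `ε` is at most half the circumference, so going around is not
  -- shorter.
  rw [(AddCircle.norm_coe_eq_abs_iff _ hp.ne').2, hx]
  rw [hx, abs_of_pos hp]
  nlinarith

lemma torusDist_cellCenter_fst (M : Network K m) {a b c : Fin m}
    (h : (a : ℕ) + 1 = b ∨ (b : ℕ) + 1 = a) :
    torusDist (cellCenter M.ε m (a, c)) (cellCenter M.ε m (b, c)) = M.ε := by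
  have hε := M.ε_pos
  have hm : 2 ≤ m := by omega
  have : ‖((((a : ℕ) : ℝ) * M.ε - ((b : ℕ) : ℝ) * M.ε : ℝ) : AddCircle ((m : ℝ) * M.ε))‖
      = M.ε := by
    refine M.norm_coe_eps hm _ ?_
    rcases h with h | h
    · rw [← h]; push_cast; ring_nf; rw [abs_neg, abs_of_pos hε]
    · rw [← h]; push_cast; ring_nf; rw [abs_of_pos hε]
  simp only [torusDist, cellCenter]
  rw [← AddCircle.coe_sub, this, sub_self, norm_zero]
  simp [Real.sqrt_sq hε.le]

lemma torusDist_cellCenter_snd (M : Network K m) {a b c : Fin m}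
    (h : (a : ℕ) + 1 = b ∨ (b : ℕ) + 1 = a) :
    torusDist (cellCenter M.ε m (c, a)) (cellCenter M.ε m (c, b)) = M.ε := by
  have := M.torusDist_cellCenter_fst (c := c) h
  simp only [torusDist, cellCenter] at this ⊢
  rwa [add_comm]

lemma upperPathLoss_fst (M : Network K m) {a b c : Fin m}
    (h : (a : ℕ) + 1 = b ∨ (b : ℕ) + 1 = a) : M.upperPathLoss (a, c) (b, c) = 1 :=
  M.upperPathLoss_eq_one _ (M.cellCenter_mem_vicinity _)
    (Or.inr (M.torusDist_cellCenter_fst h))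

lemma upperPathLoss_snd (M : Network K m) {a b c : Fin m}
    (h : (a : ℕ) + 1 = b ∨ (b : ℕ) + 1 = a) : M.upperPathLoss (c, a) (c, b) = 1 :=
  M.upperPathLoss_eq_one _ (M.cellCenter_mem_vicinity _)
    (Or.inr (M.torusDist_cellCenter_snd h))

lemma _root_.Fin.forall_of_adjacent {Q : Fin m → Prop}
    (step : ∀ a b : Fin m, ((a : ℕ) + 1 = b ∨ (b : ℕ) + 1 = a) → Q a → Q b)
    {a : Fin m} (ha : Q a) (b : Fin m) : Q b := by
  have hm : 0 < m := a.pos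
  have key : ∀ k (h : k < m), Q ⟨k, h⟩ ↔ Q ⟨0, hm⟩ := by
    intro k
    induction k with
    | zero => intro h; rfl
    | succ k ih =>
      intro h
      rw [← ih (by omega)]
      exact ⟨step _ _ (Or.inr rfl), step _ _ (Or.inl rfl)⟩
  exact (key b b.2).2 ((key a a.2).1 ha)

/-- The cells are connected through pairs of cells with path-loss `1`. -/
lemma forall_cell_of_step (M : Network K m) {Q : Cell m → Prop}
    (step : ∀ i j, M.upperPathLoss i j = 1 → Q i → Q j) {i : Cell m} (hi : Q i) (j : Cell m) :
    Q j := by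
  have h1 : Q (j.1, i.2) :=
    Fin.forall_of_adjacent (Q := fun a => Q (a, i.2))
      (fun a b h => step _ _ (M.upperPathLoss_fst h)) hi j.1
  exact Fin.forall_of_adjacent (Q := fun a => Q (j.1, a))
      (fun a b h => step _ _ (M.upperPathLoss_snd h)) h1 j.2

/-! ### The fluid interference -/

lemma UserClass.card_pos (C : UserClass K) : (0 : ℝ) < C.1.card := by
  exact_mod_cast Finset.card_pos.2 C.2

lemma weight_nonneg (M : Network K m) (i k : Cell m) (C U : UserClass K) :
    0 ≤ ((C.1 ∩ U.1).card : ℝ) * M.upperPathLoss k i :=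
  mul_nonneg (Nat.cast_nonneg _) (M.upperPathLoss_nonneg _ _)

lemma fluidInterference_mono (M : Network K m) {x y : Cell m → UserClass K → ℝ}
    (h : ∀ i C, x i C ≤ y i C) (i : Cell m) (C : UserClass K) :
    M.fluidInterference x i C ≤ M.fluidInterference y i C :=
  Finset.sum_le_sum fun k _ => Finset.sum_le_sum fun U _ =>
    mul_le_mul_of_nonneg_left (h k U) (M.weight_nonneg i k C U)

lemma fluidInterference_smul (M : Network K m) (c : ℝ) (x : Cell m → UserClass K → ℝ)
    (i : Cell m) (C : UserClass K) :
    M.fluidInterference (fun k U => c * x k U) i C = c * M.fluidInterference x i C := by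
  simp only [fluidInterference, Finset.mul_sum]
  exact Finset.sum_congr rfl fun k _ => Finset.sum_congr rfl fun U _ => by ring

lemma continuous_fluidInterference (M : Network K m) (i : Cell m) (C : UserClass K) :
    Continuous fun x => M.fluidInterference x i C := by
  unfold fluidInterference; fun_prop

lemma le_fluidInterference (M : Network K m) {x : Cell m → UserClass K → ℝ}
    (hx : ∀ i C, 0 ≤ x i C) (i k : Cell m) (C U : UserClass K) :
    ((C.1 ∩ U.1).card : ℝ) * M.upperPathLoss k i * x k U ≤ M.fluidInterference x i C := by
  have hn : ∀ k U, 0 ≤ ((C.1 ∩ U.1).card : ℝ) * M.upperPathLoss k i * x k U :=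
    fun k U => mul_nonneg (M.weight_nonneg i k C U) (hx k U)
  calc _ ≤ ∑ U : UserClass K, ((C.1 ∩ U.1).card : ℝ) * M.upperPathLoss k i * x k U :=
        Finset.single_le_sum (f := fun U : UserClass K =>
          ((C.1 ∩ U.1).card : ℝ) * M.upperPathLoss k i * x k U) (fun U _ => hn k U)
          (Finset.mem_univ U)
    _ ≤ _ := Finset.single_le_sum (f := fun k => ∑ U : UserClass K,
          ((C.1 ∩ U.1).card : ℝ) * M.upperPathLoss k i * x k U)
          (fun k _ => Finset.sum_nonneg fun U _ => hn k U) (Finset.mem_univ k)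

lemma fluidInterference_nonneg (M : Network K m) {x : Cell m → UserClass K → ℝ}
    (hx : ∀ i C, 0 ≤ x i C) (i : Cell m) (C : UserClass K) : 0 ≤ M.fluidInterference x i C :=
  (mul_nonneg (M.weight_nonneg i i C C) (hx i C)).trans (M.le_fluidInterference hx i i C C)

/-- Keeping only the diagonal term already bounds the fluid departure ratio by 1, however small the
denominator. -/
lemma card_mul_le_fluidInterference (M : Network K m) {x : Cell m → UserClass K → ℝ}
    (hx : ∀ i C, 0 ≤ x i C) (i : Cell m) (C : UserClass K) :
    (C.1.card : ℝ) * x i C ≤ M.fluidInterference x i C := by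
  have h := M.le_fluidInterference hx i i C C
  rwa [Finset.inter_self, M.upperPathLoss_self, mul_one] at h

lemma fluidInterference_pos_of_inter (M : Network K m) {x : Cell m → UserClass K → ℝ}
    (hx : ∀ i C, 0 ≤ x i C) {i k : Cell m} {C U : UserClass K} (hki : M.upperPathLoss k i = 1)
    (hCU : (C.1 ∩ U.1).Nonempty) (hpos : 0 < x k U) : 0 < M.fluidInterference x i C := by
  refine lt_of_lt_of_le ?_ (M.le_fluidInterference hx i k C U)
  rw [hki, mul_one]
  exact mul_pos (by exact_mod_cast Finset.card_pos.2 hCU) hpos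

lemma fluidInterference_pos (M : Network K m) {x : Cell m → UserClass K → ℝ}
    (hx : ∀ i C, 0 ≤ x i C) {i : Cell m} {C : UserClass K} (hpos : 0 < x i C) :
    0 < M.fluidInterference x i C :=
  (mul_pos (UserClass.card_pos C) hpos).trans_le (M.card_mul_le_fluidInterference hx i C)

lemma exists_pos_of_ne_zero {x : Cell m → UserClass K → ℝ} (hx : ∀ i C, 0 ≤ x i C) (h : x ≠ 0) :
    ∃ i C, 0 < x i C := by
  by_contra! hc
  exact h (funext fun i => funext fun C => le_antisymm (hc i C) (hx i C))

end Network

/-! ### First times -/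

lemma exists_first_nonpos {ι : Type*} [Finite ι] {T : ℝ} {g : ι → ℝ → ℝ}
    (hc : ∀ i, ContinuousOn (g i) (Set.Icc 0 T)) {t : ℝ} (ht : t ∈ Set.Icc 0 T) {i : ι}
    (hi : g i t ≤ 0) :
    ∃ s ∈ Set.Icc 0 T, s ≤ t ∧ (∃ j, g j s ≤ 0) ∧ ∀ u ∈ Set.Ico 0 s, ∀ j, 0 < g j u := by
  set S : Set ℝ := ⋃ j, Set.Icc 0 T ∩ g j ⁻¹' Set.Iic 0
  have hS : IsClosed S := isClosed_iUnion_of_finite fun j =>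
    (hc j).preimage_isClosed_of_isClosed isClosed_Icc isClosed_Iic
  have hmem : ∀ u, u ∈ S ↔ u ∈ Set.Icc 0 T ∧ ∃ j, g j u ≤ 0 := by
    intro u; simp [S]
  have hbdd : BddBelow S := ⟨0, fun u hu => ((hmem u).1 hu).1.1⟩
  have htS : t ∈ S := (hmem t).2 ⟨ht, i, hi⟩
  have hs := (hmem _).1 (hS.csInf_mem ⟨t, htS⟩ hbdd)
  refine ⟨sInf S, hs.1, csInf_le hbdd htS, hs.2, fun u hu j => ?_⟩
  by_contra! h
  exact absurd (csInf_le hbdd ((hmem u).2 ⟨⟨hu.1, hu.2.le.trans hs.1.2⟩, j, h⟩)) (not_le.2 hu.2)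

/-- At a first zero the left slopes are nonpositive, which contradicts a positive derivative. The
derivative is only needed when all the functions are nonnegative, which is exactly when the
comparison has its inequalities. -/
lemma pos_of_deriv_pos_at_zeros {ι : Type*} [Finite ι] {T : ℝ} {g : ι → ℝ → ℝ}
    (hc : ∀ i, ContinuousOn (g i) (Set.Icc 0 T)) (h0 : ∀ i, 0 < g i 0)
    (hd : ∀ i, ∀ t ∈ Set.Ioc 0 T, (∀ j, 0 ≤ g j t) → g i t = 0 →
      ∃ d, 0 < d ∧ HasDerivAt (g i) d t) :
    ∀ t ∈ Set.Icc 0 T, ∀ i, 0 < g i t := by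
  by_contra! h
  obtain ⟨t, ht, i, hi⟩ := h
  obtain ⟨s, hs, -, ⟨j, hj⟩, hlt⟩ := exists_first_nonpos hc ht hi
  have hs0 : 0 < s := by
    refine lt_of_le_of_ne hs.1 ?_
    rintro rfl
    exact absurd hj (not_le.2 (h0 j))
  have hnn : ∀ j, 0 ≤ g j s := by
    intro j
    have hten : Tendsto (g j) (𝓝[Set.Ioo 0 s] s) (𝓝 (g j s)) :=
      ((hc j) s hs).mono_left
        (nhdsWithin_mono _ fun u hu => ⟨hu.1.le, hu.2.le.trans hs.2⟩)
    have : (𝓝[Set.Ioo 0 s] s).NeBot := right_nhdsWithin_Ioo_neBot hs0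
    refine ge_of_tendsto hten ?_
    filter_upwards [self_mem_nhdsWithin] with u hu
    exact (hlt u ⟨hu.1.le, hu.2⟩ j).le
  have hjs : g j s = 0 := le_antisymm hj (hnn j)
  obtain ⟨d, hd0, hd⟩ := hd j s ⟨hs0, hs.2⟩ hnn hjs
  have hsl := (hasDerivAt_iff_tendsto_slope.1 hd).mono_left
    (nhdsWithin_mono s (fun u (hu : u ∈ Set.Ioo 0 s) => hu.2.ne))
  have : (𝓝[Set.Ioo 0 s] s).NeBot := right_nhdsWithin_Ioo_neBot hs0
  refine absurd (le_of_tendsto hsl (b := 0) ?_) (not_le.2 hd0)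
  filter_upwards [self_mem_nhdsWithin] with u hu
  rw [slope_def_field, hjs]
  exact div_nonpos_of_nonneg_of_nonpos (by linarith [hlt u ⟨hu.1.le, hu.2⟩ j])
    (by linarith [hu.2])

/-! ### Weak fluid solutions, scaling and comparison -/

namespace Network

variable {K m : ℕ}

/-- A nonnegative continuous function that satisfies the fluid equation of each coordinate
at the positive times at which the interference of that coordinate is positive. -/
structure IsWeakFluidSolution (M : Network K m) (x : ℝ → Cell m → UserClass K → ℝ) : Prop where
  continuousOn : ∀ i C, ContinuousOn (fun t => x t i C) (Set.Ici 0)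
  nonneg : ∀ t, 0 ≤ t → ∀ i C, 0 ≤ x t i C
  ode : ∀ t, 0 < t → ∀ i C, 0 < M.fluidInterference (x t) i C →
    HasDerivAt (fun s => x s i C)
      (M.lam * M.p C * M.ε ^ 2
        - 1 / M.L C * ((C.1.card : ℝ) * x t i C / M.fluidInterference (x t) i C)) t

variable {M : Network K m} {x y z : ℝ → Cell m → UserClass K → ℝ}
  {x₀ : Cell m → UserClass K → ℝ}

lemma IsFluidSolution.isWeakFluidSolution (hx : M.IsFluidSolution x₀ x) :
    M.IsWeakFluidSolution x where
  continuousOn i C := (continuous_apply_apply i C).comp_continuousOn hx.continuousOn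
  nonneg := hx.nonneg
  ode t ht i C hI := hx.ode t ht
    (by rintro h; rw [h] at hI; simp [fluidInterference] at hI) i C

namespace IsWeakFluidSolution

lemma rescale (hx : M.IsWeakFluidSolution x) {c s : ℝ} (hc : 0 < c) (hs : 0 ≤ s) :
    M.IsWeakFluidSolution (fun t i C => c * x (s + t / c) i C) where
  continuousOn i C := by
    refine ContinuousOn.mul continuousOn_const
      ((hx.continuousOn i C).comp (by fun_prop) fun t ht => ?_)
    have : 0 ≤ t / c := div_nonneg ht hc.le
    exact Set.mem_Ici.2 (by linarith)
  nonneg t ht i C := mul_nonneg hc.le (hx.nonneg _ (by positivity) i C)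
  ode t ht i C hI := by
    rw [fluidInterference_smul] at hI ⊢
    have h := hx.ode (s + t / c) (by positivity) i C (by rwa [mul_pos_iff_of_pos_left hc] at hI)
    have h2 : HasDerivAt (fun t => s + t / c) (1 / c) t :=
      ((hasDerivAt_id t).div_const c).const_add s
    refine ((h.comp t h2).const_mul c).congr_deriv ?_
    rw [mul_left_comm _ c, mul_div_mul_left _ _ hc.ne']
    field_simp

lemma drift_lower (hx : M.IsWeakFluidSolution x) {t : ℝ} (ht : 0 ≤ t) (i : Cell m)
    (C : UserClass K) :
    -(1 / M.L C) ≤ M.lam * M.p C * M.ε ^ 2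
        - 1 / M.L C * ((C.1.card : ℝ) * x t i C / M.fluidInterference (x t) i C) := by
  have h1 : 0 ≤ M.lam * M.p C * M.ε ^ 2 :=
    mul_nonneg (mul_nonneg M.lam_pos.le (M.p_nonneg C)) (sq_nonneg _)
  have h2 : (C.1.card : ℝ) * x t i C / M.fluidInterference (x t) i C ≤ 1 :=
    div_le_one_of_le₀ (M.card_mul_le_fluidInterference (hx.nonneg t ht) i C)
      (M.fluidInterference_nonneg (hx.nonneg t ht) i C)
  have h3 : 0 < 1 / M.L C := one_div_pos.2 (M.L_pos C)
  nlinarith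

/-- Comparison with a solution with positive coordinates. -/
lemma le_of_pos (hx : M.IsWeakFluidSolution x) (hy : M.IsWeakFluidSolution y) {T : ℝ}
    (hT : 0 ≤ T) (hpos : ∀ t ∈ Set.Icc 0 T, ∀ i C, 0 < x t i C)
    (h0 : ∀ i C, y 0 i C ≤ x 0 i C) (i : Cell m) (C : UserClass K) : y T i C ≤ x T i C := by
  have hsub : Set.Icc 0 T ⊆ Set.Ici (0 : ℝ) := fun t ht => ht.1
  have hmin : ∀ q : Cell m × UserClass K, ∃ c, 0 < c ∧ ∀ t ∈ Set.Icc 0 T, c ≤ x t q.1 q.2 := by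
    intro q
    obtain ⟨s, hs, hs'⟩ := isCompact_Icc.exists_isMinOn (Set.nonempty_Icc.2 hT)
      ((hx.continuousOn q.1 q.2).mono hsub)
    exact ⟨_, hpos s hs q.1 q.2, fun t ht => hs' ht⟩
  choose c hc hcx using hmin
  -- The rate `κ` is so large that the growth of the factor `1 + ε * exp (κ t)` outweighs the worst
  -- drift `-1 / L` of every coordinate.
  set κ : ℝ := ∑ q : Cell m × UserClass K, 2 * (1 / M.L q.2) / c q
  have hκ : ∀ i C, ∀ t ∈ Set.Icc 0 T, 1 / M.L C < κ * x t i C := by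
    intro i C t ht
    have hL : 0 < 1 / M.L C := one_div_pos.2 (M.L_pos C)
    have h1 : 2 * (1 / M.L C) / c (i, C) ≤ κ :=
      Finset.single_le_sum (f := fun q : Cell m × UserClass K => 2 * (1 / M.L q.2) / c q)
        (fun q _ => div_nonneg (mul_nonneg zero_le_two (one_div_pos.2 (M.L_pos _)).le)
          (hc q).le) (Finset.mem_univ (i, C))
    have h2 : 2 * (1 / M.L C) / c (i, C) * c (i, C) ≤ κ * x t i C :=
      mul_le_mul h1 (hcx (i, C) t ht) (hc _).le ((div_nonneg (by linarith) (hc _).le).trans h1)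
    rw [div_mul_cancel₀ _ (hc _).ne'] at h2
    linarith
  have key : ∀ ε : ℝ, 0 < ε → y T i C ≤ (1 + ε * Real.exp (κ * T)) * x T i C := by
    intro ε hε
    have := pos_of_deriv_pos_at_zeros (T := T)
      (g := fun (q : Cell m × UserClass K) t =>
        (1 + ε * Real.exp (κ * t)) * x t q.1 q.2 - y t q.1 q.2) ?_ ?_ ?_ T ⟨hT, le_rfl⟩ (i, C)
    · linarith
    · intro q
      exact ContinuousOn.sub (ContinuousOn.mul (by fun_prop) ((hx.continuousOn _ _).mono hsub))
        ((hy.continuousOn _ _).mono hsub)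
    · intro q
      have := mul_pos hε (hpos 0 ⟨le_rfl, hT⟩ q.1 q.2)
      have := h0 q.1 q.2
      simp only [mul_zero, Real.exp_zero, mul_one]
      linarith
    · rintro ⟨i, C⟩ t ht hnn hz
      dsimp only at hz ⊢
      have htI : t ∈ Set.Icc 0 T := ⟨ht.1.le, ht.2⟩
      set δ : ℝ := ε * Real.exp (κ * t) with hδ
      have hδ0 : 0 < δ := by positivity
      have hxt := hpos t htI i C
      have hyt : 0 < y t i C := by nlinarith
      have hIx := M.fluidInterference_pos (hx.nonneg t ht.1.le) hxt
      have hIy := M.fluidInterference_pos (hy.nonneg t ht.1.le) hyt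
      have hIle : M.fluidInterference (y t) i C ≤ (1 + δ) * M.fluidInterference (x t) i C := by
        rw [← fluidInterference_smul]
        exact M.fluidInterference_mono (fun k U => by linarith [hnn (k, U)]) i C
      have hexp : HasDerivAt (fun t => 1 + ε * Real.exp (κ * t)) (κ * δ) t := by
        refine ((((hasDerivAt_id t).const_mul κ).exp.const_mul ε).const_add 1).congr_deriv ?_
        simp only [hδ, id_eq]
        ring
      -- At contact, the numerator of `y` is exactly `1 + δ` times that of `x`, while its
      -- interference is at most `1 + δ` times as large.
      have hratio : (C.1.card : ℝ) * x t i C / M.fluidInterference (x t) i C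
          ≤ (C.1.card : ℝ) * y t i C / M.fluidInterference (y t) i C := by
        rw [div_le_div_iff₀ hIx hIy]
        have hyx : y t i C = (1 + δ) * x t i C := by linarith
        rw [hyx]
        have : 0 ≤ (C.1.card : ℝ) * x t i C := by positivity
        nlinarith
      refine ⟨_, ?_, (hexp.mul (hx.ode t ht.1 i C hIx)).sub (hy.ode t ht.1 i C hIy)⟩
      have hd := hx.drift_lower ht.1.le i C
      have hk := hκ i C t htI
      have hL : 0 < 1 / M.L C := one_div_pos.2 (M.L_pos C)
      have hr := mul_le_mul_of_nonneg_left hratio hL.le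
      simp only [← hδ]
      set dx := M.lam * M.p C * M.ε ^ 2
        - 1 / M.L C * ((C.1.card : ℝ) * x t i C / M.fluidInterference (x t) i C)
      set dy := M.lam * M.p C * M.ε ^ 2
        - 1 / M.L C * ((C.1.card : ℝ) * y t i C / M.fluidInterference (y t) i C)
      -- The derivative `κ * δ * x + (1 + δ) * dx - dy` is then at least `δ * (κ * x + dx)`, which
      -- is positive by the choice of `κ`.
      have h1 : dy ≤ dx := by simp only [dx, dy]; linarith
      nlinarith
  refine ge_of_tendsto (b := y T i C) (f := fun ε : ℝ => (1 + ε * Real.exp (κ * T)) * x T i C)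
    (x := 𝓝[>] 0) ?_ (by filter_upwards [self_mem_nhdsWithin] with ε hε using key ε hε)
  have : Continuous fun ε : ℝ => (1 + ε * Real.exp (κ * T)) * x T i C := by fun_prop
  have h := (this.tendsto 0).mono_left (nhdsWithin_le_nhds (s := Set.Ioi 0))
  simpa using h

/-! ### Positivity -/

/-- A zero would be an interior minimum at which the derivative equals the positive arrival rate. -/
lemma pos_of_arrivals (hx : M.IsWeakFluidSolution x) {t : ℝ} (ht : 0 < t) {i : Cell m}
    {C : UserClass K} (hp : 0 < M.p C) (hI : 0 < M.fluidInterference (x t) i C) :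
    0 < x t i C := by
  refine lt_of_le_of_ne (hx.nonneg t ht.le i C) fun h => ?_
  have hmin : IsLocalMin (fun s => x s i C) t := by
    filter_upwards [Ioi_mem_nhds ht] with s hs
    rw [← h]
    exact hx.nonneg s (le_of_lt hs) i C
  have := hmin.hasDerivAt_eq_zero (hx.ode t ht i C hI)
  rw [← h, mul_zero, zero_div, mul_zero, sub_zero] at this
  exact (mul_pos (mul_pos M.lam_pos hp) (pow_pos M.ε_pos 2)).ne' this

/-- By compactness the interference stays above some `c > 0`, so the decay is at most exponential:
`x * exp (κ t)` is nondecreasing. -/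
lemma pos_of_initial (hx : M.IsWeakFluidSolution x) {T : ℝ} (hT : 0 ≤ T) {i : Cell m}
    {C : UserClass K} (h0 : 0 < x 0 i C)
    (hI : ∀ t ∈ Set.Ioc 0 T, 0 < M.fluidInterference (x t) i C) : 0 < x T i C := by
  have hsub : Set.Icc 0 T ⊆ Set.Ici (0 : ℝ) := fun t ht => ht.1
  have hcont : ContinuousOn (fun t => M.fluidInterference (x t) i C) (Set.Icc 0 T) :=
    (M.continuous_fluidInterference i C).comp_continuousOn (continuousOn_pi.2 fun k =>
      continuousOn_pi.2 fun U => (hx.continuousOn k U).mono hsub)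
  have hI' : ∀ t ∈ Set.Icc 0 T, 0 < M.fluidInterference (x t) i C := by
    intro t ht
    rcases ht.1.eq_or_lt with rfl | h
    · exact M.fluidInterference_pos (hx.nonneg 0 le_rfl) h0
    · exact hI t ⟨h, ht.2⟩
  obtain ⟨s, hs, hmin⟩ := isCompact_Icc.exists_isMinOn (Set.nonempty_Icc.2 hT) hcont
  set c := M.fluidInterference (x s) i C
  have hc : 0 < c := hI' s hs
  set κ : ℝ := 1 / M.L C * C.1.card / c
  have hder : ∀ t ∈ Set.Ioo 0 T, ∃ d, 0 ≤ d ∧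
      HasDerivAt (fun t => x t i C * Real.exp (κ * t)) d t := by
    intro t ht
    have hexp : HasDerivAt (fun t => Real.exp (κ * t)) (Real.exp (κ * t) * κ) t := by
      simpa using ((hasDerivAt_id t).const_mul κ).exp
    have hIt := hI t ⟨ht.1, ht.2.le⟩
    refine ⟨_, ?_, (hx.ode t ht.1 i C hIt).mul hexp⟩
    have h1 : 0 ≤ M.lam * M.p C * M.ε ^ 2 :=
      mul_nonneg (mul_nonneg M.lam_pos.le (M.p_nonneg C)) (sq_nonneg _)
    have hL : 0 < 1 / M.L C := one_div_pos.2 (M.L_pos C)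
    have hxt := hx.nonneg t ht.1.le i C
    have h2 : (C.1.card : ℝ) * x t i C / M.fluidInterference (x t) i C
        ≤ (C.1.card : ℝ) * x t i C / c :=
      div_le_div_of_nonneg_left (by positivity) hc (hmin ⟨ht.1.le, ht.2.le⟩)
    have h3 := mul_le_mul_of_nonneg_left h2 hL.le
    have h4 : 1 / M.L C * ((C.1.card : ℝ) * x t i C / c) = κ * x t i C := by
      simp only [κ]; ring
    rw [h4] at h3
    have he := Real.exp_pos (κ * t)
    nlinarith
  have hmono : MonotoneOn (fun t => x t i C * Real.exp (κ * t)) (Set.Icc 0 T) := by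
    refine monotoneOn_of_deriv_nonneg (convex_Icc 0 T)
      (ContinuousOn.mul ((hx.continuousOn i C).mono hsub) (by fun_prop)) ?_ ?_
    · rw [interior_Icc]
      intro t ht
      obtain ⟨d, -, hd⟩ := hder t ht
      exact hd.differentiableAt.differentiableWithinAt
    · rw [interior_Icc]
      intro t ht
      obtain ⟨d, hd0, hd⟩ := hder t ht
      rwa [hd.deriv]
  have := hmono ⟨le_rfl, hT⟩ ⟨hT, le_rfl⟩ hT
  simp only [mul_zero, Real.exp_zero, mul_one] at this
  exact pos_of_mul_pos_left (h0.trans_le this) (Real.exp_pos _).le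

end IsWeakFluidSolution

/-- The class of all channels meets every class, so any mass in a cell makes its coordinate there
positive; positivity then spreads through adjacent cells. -/
lemma forall_pos_of_full (M : Network K m) {v : Cell m → UserClass K → ℝ}
    (hv : ∀ i C, 0 ≤ v i C) (hne : v ≠ 0) {F : UserClass K} (hF : F.1 = Finset.univ)
    (h : ∀ i, 0 < M.fluidInterference v i F → 0 < v i F) (i : Cell m) : 0 < v i F := by
  obtain ⟨k, U, hk⟩ := exists_pos_of_ne_zero hv hne
  refine M.forall_cell_of_step (Q := fun i => 0 < v i F) (fun i j hij hi => h j ?_) (h k ?_) i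
  · exact M.fluidInterference_pos_of_inter hv hij (by simpa using F.2) hi
  · exact M.fluidInterference_pos_of_inter hv (M.upperPathLoss_self k)
      (by rw [hF, Finset.univ_inter]; exact U.2) hk

namespace IsWeakFluidSolution

/-- A solution with coordinates fed by initial users or by arrivals has positive coordinates,
as long as it has not visited `0`. -/
lemma pos_of_ne_zero (hx : M.IsWeakFluidSolution x) (hp : ∀ i C, 0 < x 0 i C ∨ 0 < M.p C)
    {T : ℝ} (hT : 0 < T) (hne : ∀ t ∈ Set.Icc 0 T, x t ≠ 0) (i : Cell m) (C : UserClass K) :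
    0 < x T i C := by
  obtain ⟨c, -⟩ := C.2
  set F : UserClass K := ⟨Finset.univ, ⟨c, Finset.mem_univ c⟩⟩
  have hF : F.1 = Finset.univ := rfl
  have hfull : ∀ t ∈ Set.Ioc 0 T, ∀ i, 0 < x t i F := by
    by_cases hpF : 0 < M.p F
    · exact fun t ht => M.forall_pos_of_full (hx.nonneg t ht.1.le) (hne t ⟨ht.1.le, ht.2⟩) hF
        fun i hI => hx.pos_of_arrivals ht.1 hpF hI
    -- Without arrivals, this class is present in every cell initially. Before its first zero `s`
    -- its own mass keeps the interference positive; at `s` the premise of `forall_pos_of_full`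
    -- supplies it.
    · by_contra! h
      obtain ⟨t, ht, i, hi⟩ := h
      obtain ⟨s, hs, -, ⟨j, hj⟩, hlt⟩ := exists_first_nonpos (T := T)
        (g := fun i t => x t i F) (fun i => (hx.continuousOn i F).mono fun t ht => ht.1)
        ⟨ht.1.le, ht.2⟩ hi
      refine absurd hj (not_le.2 ?_)
      refine M.forall_pos_of_full (hx.nonneg s hs.1) (hne s hs) hF (fun i hI => ?_) j
      refine hx.pos_of_initial hs.1 ((hp i F).resolve_right hpF) fun u hu => ?_
      rcases hu.2.eq_or_lt with rfl | h
      · exact hI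
      · exact M.fluidInterference_pos (hx.nonneg u hu.1.le) (hlt u ⟨hu.1.le, h⟩ i)
  have hI : ∀ t ∈ Set.Ioc 0 T, 0 < M.fluidInterference (x t) i C := fun t ht =>
    M.fluidInterference_pos_of_inter (hx.nonneg t ht.1.le) (M.upperPathLoss_self i)
      (by rw [hF, Finset.inter_univ]; exact C.2) (hfull t ht i)
  rcases hp i C with h | h
  · exact hx.pos_of_initial hT.le h hI
  · exact hx.pos_of_arrivals hT h (hI T ⟨hT, le_rfl⟩)

/-! ### Uniqueness -/

/-- Coordinates of `x` may start at 0, so `le_of_pos` is applied to `(1 + δ) * x (s + t / (1 + δ))`.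
The shift `s > 0` makes it positive from the start, and the factor `1 + δ` preserves the initial
order for small `s`. Then `s → 0` and `δ → 0`. -/
lemma le_of_ne_zero (hx : M.IsWeakFluidSolution x) (hy : M.IsWeakFluidSolution y)
    (hp : ∀ i C, 0 < x 0 i C ∨ 0 < M.p C) (h0 : ∀ i C, y 0 i C ≤ x 0 i C) {T : ℝ}
    (hT : 0 < T) (hne : ∀ t ∈ Set.Ico 0 T, x t ≠ 0) (i : Cell m) (C : UserClass K) :
    y T i C ≤ x T i C := by
  have key : ∀ δ : ℝ, 0 < δ → y T i C ≤ (1 + δ) * x (T / (1 + δ)) i C := by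
    intro δ hδ
    have hδ1 : T / (1 + δ) < T := div_lt_self hT (by linarith)
    have hδ0 : 0 < T / (1 + δ) := by positivity
    have hev : ∀ᶠ s in 𝓝[>] (0 : ℝ), ∀ i C, y 0 i C ≤ (1 + δ) * x s i C := by
      refine eventually_all.2 fun i => eventually_all.2 fun C => ?_
      rcases (hx.nonneg 0 le_rfl i C).eq_or_lt with h | h
      · filter_upwards [self_mem_nhdsWithin] with s hs
        have := hx.nonneg s (le_of_lt hs) i C
        have := h0 i C
        rw [← h] at this
        exact this.trans (by positivity)
      · have hten : Tendsto (fun s => (1 + δ) * x s i C) (𝓝[>] 0) (𝓝 ((1 + δ) * x 0 i C)) :=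
          (((hx.continuousOn i C) 0 Set.self_mem_Ici).mono_left
            (nhdsWithin_mono _ Set.Ioi_subset_Ici_self)).const_mul _
        have hlt : y 0 i C < (1 + δ) * x 0 i C := by nlinarith [h0 i C]
        filter_upwards [hten.eventually_const_lt hlt] with s hs using hs.le
    have hten : Tendsto (fun s => (1 + δ) * x (s + T / (1 + δ)) i C) (𝓝[>] 0)
        (𝓝 ((1 + δ) * x (T / (1 + δ)) i C)) := by
      refine Tendsto.const_mul _ ?_
      have hcx := (hx.continuousOn i C).continuousAt (Ici_mem_nhds hδ0)
      refine hcx.tendsto.comp ?_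
      have : Continuous fun s : ℝ => s + T / (1 + δ) := by fun_prop
      have := (this.tendsto 0).mono_left (nhdsWithin_le_nhds (s := Set.Ioi 0))
      rwa [zero_add] at this
    refine ge_of_tendsto hten ?_
    -- The bound `s < T - T / (1 + δ)` keeps the rescaled solution within times before `T`, where
    -- `x` does not vanish.
    filter_upwards [hev, self_mem_nhdsWithin,
      nhdsWithin_le_nhds (Iio_mem_nhds (sub_pos.2 hδ1))] with s hs hs0 hs1
    have hs0 : 0 < s := hs0
    have hs1 : s < T - T / (1 + δ) := hs1
    refine le_of_pos (x := fun t i C => (1 + δ) * x (s + t / (1 + δ)) i C)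
      (hx.rescale (by linarith) hs0.le) hy hT.le ?_ (by simpa using hs) i C
    intro t ht i C
    have h1 : 0 ≤ t / (1 + δ) := div_nonneg ht.1 (by linarith)
    have h2 : t / (1 + δ) ≤ T / (1 + δ) := div_le_div_of_nonneg_right ht.2 (by linarith)
    have := hx.pos_of_ne_zero hp (T := s + t / (1 + δ)) (by linarith)
      (fun u hu => hne u ⟨hu.1, by linarith [hu.2]⟩) i C
    positivity
  have hcont : ContinuousAt (fun δ : ℝ => (1 + δ) * x (T / (1 + δ)) i C) 0 := by
    refine ContinuousAt.mul (by fun_prop) ?_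
    have h1 : ContinuousAt (fun δ : ℝ => T / (1 + δ)) 0 :=
      ContinuousAt.div (by fun_prop) (by fun_prop) (by norm_num)
    refine ContinuousAt.comp (g := fun t => x t i C) (f := fun δ : ℝ => T / (1 + δ)) ?_ h1
    simpa using (hx.continuousOn i C).continuousAt (Ici_mem_nhds hT)
  have hten := hcont.tendsto.mono_left (nhdsWithin_le_nhds (s := Set.Ioi 0))
  simp only [add_zero, div_one, one_mul] at hten
  exact ge_of_tendsto hten (by filter_upwards [self_mem_nhdsWithin] with δ hδ using key δ hδ)

/-- If some solution reaches `0`, then no solution leaves `0`. -/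
lemma eq_zero_of_initial_zero (hx : M.IsWeakFluidSolution x)
    (hp : ∀ i C, 0 < x 0 i C ∨ 0 < M.p C) {T : ℝ} (hT : 0 < T)
    (hne : ∀ t ∈ Set.Ico 0 T, x t ≠ 0) (hxT : x T = 0) (hz : M.IsWeakFluidSolution z)
    (hz0 : z 0 = 0) {t : ℝ} (ht : 0 ≤ t) : z t = 0 := by
  rcases ht.eq_or_lt with rfl | ht
  · exact hz0
  -- With the factor `T / t`, time `T` of the rescaled `z` is time `t` of `z`, so domination by `x T
  -- = 0` applies.
  have hc : 0 < T / t := by positivity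
  funext i C
  refine le_antisymm ?_ (hz.nonneg t ht.le i C)
  have := hx.le_of_ne_zero (hz.rescale hc le_rfl) hp
    (by simpa [hz0] using hx.nonneg 0 le_rfl) hT hne i C
  rw [hxT, zero_add, div_div_cancel₀ hT.ne'] at this
  exact nonpos_of_mul_nonpos_right this hc

lemma exists_first_zero (hx : M.IsWeakFluidSolution x) (h0 : x 0 ≠ 0) {t : ℝ} (ht : 0 ≤ t)
    (hxt : x t = 0) : ∃ T, 0 < T ∧ T ≤ t ∧ x T = 0 ∧ ∀ u ∈ Set.Ico 0 T, x u ≠ 0 := by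
  have hcont : ContinuousOn x (Set.Icc 0 t) := continuousOn_pi.2 fun i =>
    continuousOn_pi.2 fun C => (hx.continuousOn i C).mono fun u hu => hu.1
  obtain ⟨T, hT, hTt, ⟨-, hT0⟩, hlt⟩ := exists_first_nonpos (ι := Unit) (T := t)
    (g := fun _ u => ‖x u‖) (fun _ => hcont.norm) ⟨ht, le_rfl⟩ (i := ()) (by simp [hxt])
  have hxT : x T = 0 := norm_le_zero_iff.1 hT0
  refine ⟨T, lt_of_le_of_ne hT.1 ?_, hTt, hxT, fun u hu => norm_pos_iff.1 (hlt u hu ())⟩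
  rintro rfl
  exact h0 hxT

lemma eq_zero_of_zero (hx : M.IsWeakFluidSolution x) (hp : ∀ i C, 0 < x 0 i C ∨ 0 < M.p C)
    {T : ℝ} (hT : 0 < T) (hne : ∀ t ∈ Set.Ico 0 T, x t ≠ 0) (hxT : x T = 0)
    (hz : M.IsWeakFluidSolution z) (hzT : z T = 0) {t : ℝ} (ht : T ≤ t) : z t = 0 := by
  have := hx.eq_zero_of_initial_zero hp hT hne hxT (hz.rescale one_pos hT.le)
    (by ext; simp [hzT]) (sub_nonneg.2 ht)
  simpa using this

/-- Until the first zero of `x` this is the comparison; that zero then forces `y` to vanish too, and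
`y` stays absorbed at 0. -/
lemma le_of_initial_eq (hx : M.IsWeakFluidSolution x) (hy : M.IsWeakFluidSolution y)
    (h0 : x 0 ≠ 0) (hp : ∀ i C, 0 < x 0 i C ∨ 0 < M.p C) (hxy : y 0 = x 0) {t : ℝ}
    (ht : 0 ≤ t) (i : Cell m) (C : UserClass K) : y t i C ≤ x t i C := by
  rcases ht.eq_or_lt with rfl | ht
  · rw [hxy]
  by_cases hne : ∀ u ∈ Set.Ico 0 t, x u ≠ 0
  · exact hx.le_of_ne_zero hy hp (by simp [hxy]) ht hne i C
  push Not at hne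
  obtain ⟨s, hs, hxs⟩ := hne
  obtain ⟨T, hT, hTs, hxT, hlt⟩ := hx.exists_first_zero h0 hs.1 hxs
  have hyT : y T = 0 := by
    funext k U
    refine le_antisymm ?_ (hy.nonneg T hT.le k U)
    simpa [hxT] using hx.le_of_ne_zero hy hp (by simp [hxy]) hT hlt k U
  rw [hx.eq_zero_of_zero hp hT hlt hxT hy hyT (hTs.trans hs.2.le)]
  exact hx.nonneg t ht.le i C

lemma eq_of_initial_eq (hx : M.IsWeakFluidSolution x) (hy : M.IsWeakFluidSolution y)
    (h0 : x 0 ≠ 0) (hp : ∀ i C, 0 < x 0 i C ∨ 0 < M.p C) (hxy : y 0 = x 0) {t : ℝ}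
    (ht : 0 ≤ t) : y t = x t := by
  funext i C
  refine le_antisymm (hx.le_of_initial_eq hy h0 hp hxy ht i C) ?_
  exact hy.le_of_initial_eq hx (hxy ▸ h0) (hxy ▸ hp) hxy.symm ht i C

lemma isFluidSolution (hx : M.IsWeakFluidSolution x) (hx₀ : x 0 = x₀) (h0 : x₀ ≠ 0)
    (hp : ∀ i C, 0 < x₀ i C ∨ 0 < M.p C) : M.IsFluidSolution x₀ x := by
  subst hx₀
  have hI : ∀ t, 0 < t → x t ≠ 0 → ∀ i C, 0 < M.fluidInterference (x t) i C := by
    intro t ht hxt i C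
    refine M.fluidInterference_pos (hx.nonneg t ht.le) (hx.pos_of_ne_zero hp ht ?_ i C)
    intro s hs hxs
    obtain ⟨T, hT, hTs, hxT, hlt⟩ := hx.exists_first_zero h0 hs.1 hxs
    exact hxt (hx.eq_zero_of_zero hp hT hlt hxT hx hxT (hTs.trans hs.2))
  exact
    { continuousOn := continuousOn_pi.2 fun i => continuousOn_pi.2 fun C => hx.continuousOn i C
      nonneg := hx.nonneg
      initial := rfl
      denominator_pos := hI
      ode := fun t ht hxt i C => hx.ode t ht i C (hI t ht hxt i C) }

end IsWeakFluidSolution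

end Network

/-! ### Right-continuous functions -/

/-- The values on the grid of mesh `1 / (n + 1)`, read at the next point to the right, converge to
`f`. -/
lemma measurable_of_rightContinuous {f : ℝ → ℝ}
    (hf : ∀ t, ContinuousWithinAt f (Set.Ici t) t) : Measurable f := by
  refine measurable_of_tendsto_metrizable
    (f := fun (n : ℕ) t => f (((⌊t * ((n : ℝ) + 1)⌋ : ℝ) + 1) / ((n : ℝ) + 1))) (fun n => ?_) ?_
  · have h : Measurable fun z : ℤ => f (((z : ℝ) + 1) / ((n : ℝ) + 1)) :=
      measurable_of_countable _
    exact h.comp (Int.measurable_floor.comp (by fun_prop))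
  · refine tendsto_pi_nhds.2 fun t => (hf t).tendsto.comp ?_
    have hn : ∀ n : ℕ, (0 : ℝ) < (n : ℝ) + 1 := fun n => by positivity
    have hge : ∀ n : ℕ, t ≤ ((⌊t * ((n : ℝ) + 1)⌋ : ℝ) + 1) / ((n : ℝ) + 1) := fun n => by
      rw [le_div_iff₀ (hn n)]
      exact (Int.lt_floor_add_one _).le
    have hle : ∀ n : ℕ, ((⌊t * ((n : ℝ) + 1)⌋ : ℝ) + 1) / ((n : ℝ) + 1)
        ≤ t + 1 / ((n : ℝ) + 1) := fun n => by
      rw [div_le_iff₀ (hn n), add_mul, div_mul_cancel₀ _ (hn n).ne']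
      linarith [Int.floor_le (t * ((n : ℝ) + 1))]
    refine tendsto_nhdsWithin_iff.2 ⟨?_, Eventually.of_forall hge⟩
    refine tendsto_of_tendsto_of_tendsto_of_le_of_le tendsto_const_nhds ?_ hge hle
    simpa using (tendsto_one_div_add_atTop_nhds_zero_nat (𝕜 := ℝ)).const_add t

namespace Network

variable {K m : ℕ}

/-! ### Departure rates -/

/-- The departure intensity of the state `v` rescaled by the factor `δ`. -/
noncomputable def departureRate (M : Network K m) (v : Cell m → UserClass K → ℝ) (δ : ℝ) (i : Cell m)
    (C : UserClass K) : ℝ :=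
  (C.1.card : ℝ) * v i C / (δ * (M.noise - C.1.card) + M.fluidInterference v i C)

/-- A bound for the total transmission rate of the users of class `C` of a cell. -/
noncomputable def maxRate (M : Network K m) (C : UserClass K) : ℝ := 1 + (C.1.card : ℝ) / M.noise

lemma maxRate_pos (M : Network K m) (C : UserClass K) : 0 < M.maxRate C := by
  have := M.noise_pos
  unfold maxRate; positivity

lemma interference_eq (M : Network K m) (x : Cell m → UserClass K → ℕ) (i : Cell m)
    (C : UserClass K) :
    M.interference x i C = M.fluidInterference (fun k U => (x k U : ℝ)) i C - C.1.card := by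
  have h : ∑ k, ∑ U : UserClass K, ((C.1 ∩ U.1).card : ℝ) * M.upperPathLoss k i *
      (if U = C ∧ i = k then 1 else 0) = C.1.card := by
    rw [Finset.sum_eq_single i, Finset.sum_eq_single C]
    · simp [M.upperPathLoss_self]
    · intro U _ hU; simp [hU]
    · simp
    · intro k _ hk
      exact Finset.sum_eq_zero fun U _ => by simp [hk.symm]
    · simp
  simp only [interference, fluidInterference, mul_sub, Finset.sum_sub_distrib, h]

lemma mul_transmissionRate (M : Network K m) (x : Cell m → UserClass K → ℕ) (i : Cell m)
    (C : UserClass K) :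
    (x i C : ℝ) * M.transmissionRate x i C
      = M.departureRate (fun k U => (x k U : ℝ)) 1 i C := by
  rw [transmissionRate, departureRate, interference_eq, one_mul, mul_div_assoc', mul_comm]
  congr 1
  ring

lemma departureRate_rescale (M : Network K m) (v : Cell m → UserClass K → ℝ) {n : ℝ}
    (hn : 0 < n) (i : Cell m) (C : UserClass K) :
    M.departureRate (fun k U => v k U / n) (1 / n) i C = M.departureRate v 1 i C := by
  have h : M.fluidInterference (fun k U => v k U / n) i C = n⁻¹ * M.fluidInterference v i C := by
    rw [← fluidInterference_smul]
    simp only [div_eq_inv_mul]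
  rw [departureRate, departureRate, h, one_div, one_mul, ← mul_add, div_eq_inv_mul (v i C),
    mul_left_comm, mul_div_mul_left _ _ (inv_pos.2 hn).ne']

/-- The term `noise - |C|` may be negative, but a user that is present contributes `|C|` to the full
interference, so the denominator is at least `noise`. -/
lemma departureRate_mem (M : Network K m) (x : Cell m → UserClass K → ℕ) (i : Cell m)
    (C : UserClass K) :
    M.departureRate (fun k U => (x k U : ℝ)) 1 i C ∈ Set.Icc 0 (M.maxRate C) := by
  rcases Nat.eq_zero_or_pos (x i C) with h | h
  · simp [departureRate, h, (M.maxRate_pos C).le]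
  have hx : (1 : ℝ) ≤ x i C := by exact_mod_cast h
  have hc := UserClass.card_pos C
  have hN := M.noise_pos
  have hI := M.card_mul_le_fluidInterference (x := fun k U => (x k U : ℝ))
    (fun _ _ => Nat.cast_nonneg _) i C
  have hden : 0 < 1 * (M.noise - C.1.card)
      + M.fluidInterference (fun k U => (x k U : ℝ)) i C := by nlinarith
  refine ⟨div_nonneg (by positivity) hden.le, ?_⟩
  rw [departureRate, div_le_iff₀ hden, maxRate]
  have hd : (C.1.card : ℝ) / M.noise * M.noise = C.1.card := div_mul_cancel₀ _ hN.ne'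
  have hd0 : 0 ≤ (C.1.card : ℝ) / M.noise := by positivity
  have h2 : 0 ≤ M.fluidInterference (fun k U => (x k U : ℝ)) i C - C.1.card := by nlinarith
  nlinarith [mul_nonneg hd0 h2]

/-- Scale `δ = 0` is the fluid rate, and `δ = 1 / n` that of the rescaled chain; joint continuity
removes the noise in the limit. -/
lemma continuousAt_departureRate (M : Network K m) {v : Cell m → UserClass K → ℝ} {i : Cell m}
    {C : UserClass K} (hI : 0 < M.fluidInterference v i C) :
    ContinuousAt (fun q : (Cell m → UserClass K → ℝ) × ℝ => M.departureRate q.1 q.2 i C)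
      (v, 0) := by
  have := M.continuous_fluidInterference i C
  unfold departureRate
  refine ContinuousAt.div (by fun_prop) (by fun_prop) ?_
  simpa using hI.ne'

/-! ### Departures along a path -/

/-- The cumulated departure intensity along a path. -/
noncomputable def cumulatedDepartures (M : Network K m) (ξ : ℝ → Cell m → UserClass K → ℕ) (i : Cell m)
    (C : UserClass K) (t : ℝ) : ℝ :=
  1 / M.L C * ∫ u in (0 : ℝ)..t, (ξ u i C : ℝ) * M.transmissionRate (ξ u) i C

namespace IsDominatingPath

variable {M : Network K m} {a d : Cell m → UserClass K → ℝ≥0 → ℕ}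
  {ξ : ℝ → Cell m → UserClass K → ℕ}

lemma intervalIntegrable (h : M.IsDominatingPath a d ξ) (i : Cell m) (C : UserClass K) {s t : ℝ}
    (hs : 0 ≤ s) (ht : 0 ≤ t) :
    IntervalIntegrable (fun u => (ξ u i C : ℝ) * M.transmissionRate (ξ u) i C) volume s t := by
  set f : (Cell m → UserClass K → ℕ) → ℝ := fun x => (x i C : ℝ) * M.transmissionRate x i C
  -- Paths are right-continuous at nonnegative times only, hence the extension by `max u 0`.
  have hmeas : Measurable fun u => f (ξ (max u 0)) := by
    refine measurable_of_rightContinuous fun u => ?_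
    have hf : Continuous f := continuous_of_discreteTopology
    have h1 := h.rightContinuous (max u 0) (le_max_right _ _)
    have h2 : ContinuousWithinAt (fun u : ℝ => max u 0) (Set.Ici u) u :=
      (continuous_id.max continuous_const).continuousWithinAt
    exact hf.continuousAt.comp_continuousWithinAt
      (ContinuousWithinAt.comp (g := ξ) (f := fun u : ℝ => max u 0) h1 h2
        fun v hv => Set.mem_Ici.2 (max_le_max (Set.mem_Ici.1 hv) le_rfl))
  have hint : IntervalIntegrable (fun u => f (ξ (max u 0))) volume s t := by
    refine (intervalIntegrable_const (c := M.maxRate C)).mono_fun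
      hmeas.aestronglyMeasurable (Eventually.of_forall fun u => ?_)
    have := M.departureRate_mem (ξ (max u 0)) i C
    simp only [f, mul_transmissionRate]
    rw [Real.norm_of_nonneg this.1, Real.norm_of_nonneg (M.maxRate_pos C).le]
    exact this.2
  refine hint.congr fun u hu => ?_
  have : 0 ≤ u := (le_min hs ht).trans (Set.uIoc_subset_uIcc hu).1
  simp only [f, max_eq_left this]

lemma abs_cumulatedDepartures_sub_le (h : M.IsDominatingPath a d ξ) (i : Cell m)
    (C : UserClass K) {s t r e : ℝ} (hs : 0 ≤ s) (ht : 0 ≤ t)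
    (hr : ∀ u ∈ Set.uIcc s t, |M.departureRate (fun k U => (ξ u k U : ℝ)) 1 i C - r| ≤ e) :
    |M.cumulatedDepartures ξ i C t - M.cumulatedDepartures ξ i C s
      - 1 / M.L C * r * (t - s)| ≤ 1 / M.L C * e * |t - s| := by
  have hL : 0 < 1 / M.L C := one_div_pos.2 (M.L_pos C)
  have h1 : M.cumulatedDepartures ξ i C t - M.cumulatedDepartures ξ i C s
      - 1 / M.L C * r * (t - s) = 1 / M.L C *
        ∫ u in s..t, ((ξ u i C : ℝ) * M.transmissionRate (ξ u) i C - r) := by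
    rw [intervalIntegral.integral_sub (h.intervalIntegrable i C hs ht) intervalIntegrable_const,
      ← intervalIntegral.integral_interval_sub_left (h.intervalIntegrable i C le_rfl ht)
        (h.intervalIntegrable i C le_rfl hs), intervalIntegral.integral_const, smul_eq_mul,
      cumulatedDepartures, cumulatedDepartures]
    ring
  rw [h1, abs_mul, abs_of_pos hL, mul_assoc]
  refine mul_le_mul_of_nonneg_left ?_ hL.le
  rw [← Real.norm_eq_abs]
  refine intervalIntegral.norm_integral_le_of_norm_le_const fun u hu => ?_
  rw [mul_transmissionRate]
  exact hr u (Set.uIoc_subset_uIcc hu)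

lemma abs_cumulatedDepartures_sub_le_maxRate (h : M.IsDominatingPath a d ξ) (i : Cell m)
    (C : UserClass K) {s t : ℝ} (hs : 0 ≤ s) (ht : 0 ≤ t) :
    |M.cumulatedDepartures ξ i C t - M.cumulatedDepartures ξ i C s|
      ≤ 1 / M.L C * M.maxRate C * |t - s| := by
  have := h.abs_cumulatedDepartures_sub_le i C (r := 0) (e := M.maxRate C) hs ht
    (fun u _ => by
      have := M.departureRate_mem (ξ u) i C
      rw [sub_zero, abs_of_nonneg this.1]
      exact this.2)
  simpa using this

lemma cumulatedDepartures_mem (h : M.IsDominatingPath a d ξ) (i : Cell m)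
    (C : UserClass K) {t : ℝ} (ht : 0 ≤ t) :
    M.cumulatedDepartures ξ i C t ∈ Set.Icc 0 (1 / M.L C * M.maxRate C * t) := by
  have h1 := h.abs_cumulatedDepartures_sub_le_maxRate i C le_rfl ht
  have h0 : M.cumulatedDepartures ξ i C 0 = 0 := by simp [cumulatedDepartures]
  rw [h0, sub_zero, sub_zero, abs_of_nonneg ht] at h1
  refine ⟨mul_nonneg (one_div_pos.2 (M.L_pos C)).le ?_, (le_abs_self _).trans h1⟩
  refine intervalIntegral.integral_nonneg ht fun u _ => ?_
  rw [mul_transmissionRate]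
  exact (M.departureRate_mem (ξ u) i C).1

end IsDominatingPath

end Network

/-! ### Fluid limits of paths -/

/-- The counting path `z` satisfies the functional law of large numbers with rate `1`. -/
def HasUnitRate (z : ℝ≥0 → ℕ) : Prop :=
  ∀ S η : ℝ, 0 < η → ∀ᶠ n : ℕ in atTop, ∀ s ∈ Set.Icc 0 S,
    |(z (Real.toNNReal (n * s)) : ℝ) / n - s| ≤ η

namespace Network

variable {K m : ℕ} {M : Network K m} {a d : Cell m → UserClass K → ℝ≥0 → ℕ}
  {ξ : ℕ → ℝ → Cell m → UserClass K → ℕ} {x₀ : Cell m → UserClass K → ℝ}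

/-- The path `ξ` in which time and space are rescaled by the factor `n`. -/
noncomputable def rescaledPath (ξ : ℕ → ℝ → Cell m → UserClass K → ℕ) (n : ℕ) (t : ℝ) (i : Cell m)
    (C : UserClass K) : ℝ := (ξ n (n * t) i C : ℝ) / n

/-- The arrival rate of the users of class `C` in a cell. -/
noncomputable def arrivalRate (M : Network K m) (C : UserClass K) : ℝ := M.lam * M.p C * M.ε ^ 2

lemma arrivalRate_nonneg (M : Network K m) (C : UserClass K) : 0 ≤ M.arrivalRate C :=
  mul_nonneg (mul_nonneg M.lam_pos.le (M.p_nonneg C)) (sq_nonneg _)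

/-- Rates are bounded, so both clocks run only up to multiples of `n`, where the uniform law of
large numbers replaces the counts by their means. -/
lemma eventually_abs_rescaledPath_sub_le (ha : ∀ i C, HasUnitRate (a i C))
    (hd : ∀ i C, HasUnitRate (d i C)) (hξ : ∀ n, M.IsDominatingPath a d (ξ n)) (T : ℝ)
    {η : ℝ} (hη : 0 < η) :
    ∀ᶠ n : ℕ in atTop, ∀ t ∈ Set.Icc 0 T, ∀ i C,
      |rescaledPath ξ n t i C - ((ξ n 0 i C : ℝ) / n + M.arrivalRate C * t
        - M.cumulatedDepartures (ξ n) i C (n * t) / n)| ≤ η := by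
  have h1 : ∀ᶠ n : ℕ in atTop, ∀ i C, ∀ s ∈ Set.Icc 0 (M.arrivalRate C * T),
      |(a i C (Real.toNNReal (n * s)) : ℝ) / n - s| ≤ η / 2 :=
    eventually_all.2 fun i => eventually_all.2 fun C => ha i C _ _ (half_pos hη)
  have h2 : ∀ᶠ n : ℕ in atTop, ∀ i C, ∀ s ∈ Set.Icc 0 (1 / M.L C * M.maxRate C * T),
      |(d i C (Real.toNNReal (n * s)) : ℝ) / n - s| ≤ η / 2 :=
    eventually_all.2 fun i => eventually_all.2 fun C => hd i C _ _ (half_pos hη)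
  filter_upwards [h1, h2, eventually_gt_atTop 0] with n h1 h2 hn t ht i C
  have hn : (0 : ℝ) < n := by exact_mod_cast hn
  have hα := M.arrivalRate_nonneg C
  have hB : 0 < 1 / M.L C * M.maxRate C := mul_pos (one_div_pos.2 (M.L_pos C)) (M.maxRate_pos C)
  have hnt : 0 ≤ (n : ℝ) * t := mul_nonneg hn.le ht.1
  have hD := (hξ n).cumulatedDepartures_mem i C hnt
  have e1 := h1 i C (M.arrivalRate C * t)
    ⟨mul_nonneg hα ht.1, mul_le_mul_of_nonneg_left ht.2 hα⟩
  have e2 := h2 i C (M.cumulatedDepartures (ξ n) i C (n * t) / n) ⟨div_nonneg hD.1 hn.le, by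
    rw [div_le_iff₀ hn]
    refine hD.2.trans ?_
    have := mul_le_mul_of_nonneg_left ht.2 (mul_nonneg hB.le hn.le)
    linarith⟩
  rw [mul_div_cancel₀ _ hn.ne'] at e2
  have hdyn := (hξ n).dynamics (n * t) hnt i C
  rw [show M.lam * M.p C * M.ε ^ 2 * (n * t) = n * (M.arrivalRate C * t) by
    rw [arrivalRate]; ring] at hdyn
  change _ = _ + _ - (d i C (Real.toNNReal (M.cumulatedDepartures (ξ n) i C (n * t))) : ℝ) at hdyn
  rw [rescaledPath, hdyn, sub_div, add_div]
  rw [abs_le] at e1 e2 ⊢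
  constructor <;> linarith [e1.1, e1.2, e2.1, e2.2]

/-- A Lipschitz constant for the fluid limits. -/
noncomputable def fluidLipschitz (M : Network K m) (C : UserClass K) : ℝ :=
  M.arrivalRate C + 1 / M.L C * M.maxRate C

lemma fluidLipschitz_nonneg (M : Network K m) (C : UserClass K) : 0 ≤ M.fluidLipschitz C :=
  add_nonneg (M.arrivalRate_nonneg C)
    (mul_pos (one_div_pos.2 (M.L_pos C)) (M.maxRate_pos C)).le

lemma eventually_equicontinuous (ha : ∀ i C, HasUnitRate (a i C))
    (hd : ∀ i C, HasUnitRate (d i C)) (hξ : ∀ n, M.IsDominatingPath a d (ξ n)) (T : ℝ)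
    {η : ℝ} (hη : 0 < η) :
    ∀ᶠ n : ℕ in atTop, ∀ s ∈ Set.Icc 0 T, ∀ t ∈ Set.Icc 0 T, ∀ i C,
      |rescaledPath ξ n t i C - rescaledPath ξ n s i C| ≤ M.fluidLipschitz C * |t - s| + η := by
  filter_upwards [eventually_abs_rescaledPath_sub_le ha hd hξ T (half_pos hη),
    eventually_gt_atTop 0] with n h hn s hs t ht i C
  have hn : (0 : ℝ) < n := by exact_mod_cast hn
  have h1 := h s hs i C
  have h2 := h t ht i C
  have h3 := (hξ n).abs_cumulatedDepartures_sub_le_maxRate i C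
    (mul_nonneg hn.le hs.1) (mul_nonneg hn.le ht.1)
  rw [← mul_sub, abs_mul, abs_of_pos hn, mul_left_comm, ← div_le_iff₀' hn, ← abs_of_pos hn,
    ← abs_div, abs_of_pos hn, sub_div] at h3
  have h4 : |M.arrivalRate C * (t - s)| = M.arrivalRate C * |t - s| := by
    rw [abs_mul, abs_of_nonneg (M.arrivalRate_nonneg C)]
  have h5 := le_abs_self (M.arrivalRate C * (t - s))
  have h6 := neg_abs_le (M.arrivalRate C * (t - s))
  rw [h4] at h5 h6
  rw [fluidLipschitz, add_mul]
  rw [abs_le] at h1 h2 h3 ⊢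
  constructor <;> linarith [h1.1, h1.2, h2.1, h2.2, h3.1, h3.2]

/-! ### Ultrafilter limits of the rescaled paths and their identification -/

lemma exists_ultrafilter_limit (ha : ∀ i C, HasUnitRate (a i C))
    (hd : ∀ i C, HasUnitRate (d i C)) (hξ : ∀ n, M.IsDominatingPath a d (ξ n))
    (h0 : ∀ i C, Tendsto (fun n : ℕ => (ξ n 0 i C : ℝ) / n) atTop (𝓝 (x₀ i C)))
    (𝒰 : Ultrafilter ℕ) (h𝒰 : (𝒰 : Filter ℕ) ≤ atTop) :
    ∃ y : ℝ → Cell m → UserClass K → ℝ, ∀ t, 0 ≤ t → ∀ i C,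
      Tendsto (fun n => rescaledPath ξ n t i C) 𝒰 (𝓝 (y t i C)) := by
  have key : ∀ t i C, ∃ y : ℝ, 0 ≤ t → Tendsto (fun n => rescaledPath ξ n t i C) 𝒰 (𝓝 y) := by
    intro t i C
    by_cases ht : 0 ≤ t
    swap
    · exact ⟨0, fun h => absurd h ht⟩
    have hev : ∀ᶠ n : ℕ in atTop, rescaledPath ξ n t i C ∈
        Set.Icc 0 (x₀ i C + 1 + (M.fluidLipschitz C * t + 1)) := by
      filter_upwards [eventually_equicontinuous ha hd hξ t one_pos,
        (h0 i C).eventually_lt_const (lt_add_one _)] with n h1 h2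
      have h3 := h1 0 ⟨le_rfl, ht⟩ t ⟨ht, le_rfl⟩ i C
      have h4 : rescaledPath ξ n 0 i C = (ξ n 0 i C : ℝ) / n := by simp [rescaledPath]
      rw [h4, sub_zero, abs_of_nonneg ht] at h3
      exact ⟨by unfold rescaledPath; positivity, by linarith [(abs_le.1 h3).2]⟩
    obtain ⟨y, -, hy⟩ := isCompact_Icc.ultrafilter_le_nhds
      (𝒰.map fun n => rescaledPath ξ n t i C)
      (le_principal_iff.2 (h𝒰 hev))
    exact ⟨y, fun _ => hy⟩
  choose y hy using key
  exact ⟨y, fun t ht i C => hy t i C ht⟩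

lemma isWeakFluidSolution_of_tendsto (ha : ∀ i C, HasUnitRate (a i C))
    (hd : ∀ i C, HasUnitRate (d i C)) (hξ : ∀ n, M.IsDominatingPath a d (ξ n))
    {𝒰 : Filter ℕ} [𝒰.NeBot] (h𝒰 : 𝒰 ≤ atTop) {y : ℝ → Cell m → UserClass K → ℝ}
    (hy : ∀ t, 0 ≤ t → ∀ i C, Tendsto (fun n => rescaledPath ξ n t i C) 𝒰 (𝓝 (y t i C))) :
    M.IsWeakFluidSolution y where
  continuousOn i C := by
    refine (LipschitzOnWith.of_dist_le_mul (K := ⟨M.fluidLipschitz C, M.fluidLipschitz_nonneg C⟩)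
      fun t ht s hs => ?_).continuousOn
    rw [Set.mem_Ici] at ht hs
    refine le_of_forall_pos_le_add fun η hη => ?_
    refine le_of_tendsto ((hy t ht i C).sub (hy s hs i C)).abs ?_
    filter_upwards [h𝒰 (eventually_equicontinuous ha hd hξ (max s t) hη)] with n hn
    exact hn s ⟨hs, le_max_left _ _⟩ t ⟨ht, le_max_right _ _⟩ i C
  nonneg t ht i C := by
    refine ge_of_tendsto (hy t ht i C) (Eventually.of_forall fun n => ?_)
    unfold rescaledPath; positivity
  ode t ht i C hI := by
    have hL := M.L_pos C
    set r := (C.1.card : ℝ) * y t i C / M.fluidInterference (y t) i C with hr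
    rw [hasDerivAt_iff_isLittleO, Asymptotics.isLittleO_iff]
    intro c hc
    -- The tolerance `c * L` on the rate becomes `c` in the drift, which carries the factor `1 / L`.
    obtain ⟨ρ, hρ, hG⟩ := Metric.continuousAt_iff.1 (M.continuousAt_departureRate hI)
      (c * M.L C) (mul_pos hc hL)
    set Λ : ℝ := ∑ U : UserClass K, M.fluidLipschitz U + 1
    have hΛ : ∀ U, M.fluidLipschitz U ≤ Λ := fun U =>
      (Finset.single_le_sum (f := M.fluidLipschitz) (fun U _ => M.fluidLipschitz_nonneg U)
        (Finset.mem_univ U)).trans (le_add_of_nonneg_right zero_le_one)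
    have hΛ0 : 0 < Λ := add_pos_of_nonneg_of_pos
      (Finset.sum_nonneg fun U _ => M.fluidLipschitz_nonneg U) one_pos
    -- The budget `ρ` is split in three: the Lipschitz variation, the equicontinuity error and the
    -- convergence at `t`. The bound by `t` keeps `s` in `[0, 2 * t]`.
    have hh : 0 < min t (ρ / 3 / Λ) := lt_min ht (by positivity)
    filter_upwards [Metric.ball_mem_nhds t hh] with s hs
    rw [Metric.mem_ball, Real.dist_eq, lt_min_iff] at hs
    obtain ⟨hs1, hs2⟩ := hs
    rw [lt_div_iff₀ hΛ0] at hs2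
    have hst := abs_lt.1 hs1
    have hs0 : 0 ≤ s := by linarith
    refine le_of_forall_pos_le_add fun η hη => ?_
    simp only [smul_eq_mul, Real.norm_eq_abs]
    refine le_of_tendsto (((hy s hs0 i C).sub (hy t ht.le i C)).sub_const _).abs ?_
    have hyt : ∀ᶠ n in 𝒰, ∀ k U, |rescaledPath ξ n t k U - y t k U| < ρ / 3 :=
      eventually_all.2 fun k => eventually_all.2 fun U =>
        (hy t ht.le k U).eventually (Metric.ball_mem_nhds _ (by positivity))
    filter_upwards [hyt, h𝒰 (eventually_equicontinuous ha hd hξ (2 * t) (η := ρ / 3)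
      (by positivity)), h𝒰 (eventually_abs_rescaledPath_sub_le ha hd hξ (2 * t) (half_pos hη)),
      h𝒰 (eventually_gt_atTop 0),
      h𝒰 (tendsto_one_div_atTop_nhds_zero_nat.eventually (Metric.ball_mem_nhds (0 : ℝ) hρ))]
      with n h1 h2 h3 hn h4
    have hn : (0 : ℝ) < n := by exact_mod_cast hn
    have htm : t ∈ Set.Icc 0 (2 * t) := ⟨ht.le, by linarith⟩
    have hsm : s ∈ Set.Icc 0 (2 * t) := ⟨hs0, by linarith⟩
    have hrate : ∀ u ∈ Set.uIcc ((n : ℝ) * t) (n * s),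
        |M.departureRate (fun k U => (ξ n u k U : ℝ)) 1 i C - r| ≤ c * M.L C := by
      intro u hu
      have hu' : u / n ∈ Set.uIcc t s := by
        have := Set.mem_image_of_mem (· / (n : ℝ)) hu
        rwa [Set.image_div_const_uIcc, mul_div_cancel_left₀ _ hn.ne',
          mul_div_cancel_left₀ _ hn.ne'] at this
      have hum : u / n ∈ Set.Icc 0 (2 * t) := Set.uIcc_subset_Icc htm hsm hu'
      have hut : |u / n - t| ≤ |s - t| := Set.abs_sub_left_of_mem_uIcc hu'
      rw [← M.departureRate_rescale _ hn]
      have hclose : dist ((fun k U => (ξ n u k U : ℝ) / n), 1 / (n : ℝ)) (y t, (0 : ℝ)) < ρ := by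
        rw [Prod.dist_eq, max_lt_iff]
        refine ⟨?_, h4⟩
        rw [dist_pi_lt_iff hρ]
        intro k
        rw [dist_pi_lt_iff hρ]
        intro U
        have e1 := h1 k U
        have e2 := h2 t htm (u / n) hum k U
        have e3 : rescaledPath ξ n (u / n) k U = (ξ n u k U : ℝ) / n := by
          rw [rescaledPath, mul_div_cancel₀ _ hn.ne']
        have e4 : M.fluidLipschitz U * |u / n - t| ≤ |s - t| * Λ := by
          rw [mul_comm]
          exact mul_le_mul hut (hΛ U) (M.fluidLipschitz_nonneg U) (abs_nonneg _)
        rw [e3] at e2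
        rw [Real.dist_eq]
        have e5 := abs_sub_le ((ξ n u k U : ℝ) / n) (rescaledPath ξ n t k U) (y t k U)
        linarith
      have := hG hclose
      rw [Real.dist_eq] at this
      simpa [departureRate, hr] using this.le
    have h5 := (hξ n).abs_cumulatedDepartures_sub_le i C (mul_nonneg hn.le ht.le)
      (mul_nonneg hn.le hs0) hrate
    have h6 : |M.cumulatedDepartures (ξ n) i C (n * s) / n
        - M.cumulatedDepartures (ξ n) i C (n * t) / n - 1 / M.L C * r * (s - t)|
        ≤ c * |s - t| := by
      have e1 : M.cumulatedDepartures (ξ n) i C (n * s) / n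
        - M.cumulatedDepartures (ξ n) i C (n * t) / n - 1 / M.L C * r * (s - t)
        = (M.cumulatedDepartures (ξ n) i C (n * s) - M.cumulatedDepartures (ξ n) i C (n * t)
          - 1 / M.L C * r * (n * s - n * t)) / n := by
        field_simp
      rw [e1, abs_div, abs_of_pos hn, div_le_iff₀ hn]
      refine h5.trans_eq ?_
      rw [← mul_sub, abs_mul, abs_of_pos hn]
      field_simp
    have h7 := h3 t htm i C
    have h8 := h3 s hsm i C
    simp only [arrivalRate] at h7 h8
    rw [abs_le] at h6 h7 h8 ⊢
    constructor <;> linarith [h6.1, h6.2, h7.1, h7.2, h8.1, h8.2]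

lemma limit_zero_eq {𝒰 : Filter ℕ} [𝒰.NeBot] (h𝒰 : 𝒰 ≤ atTop)
    (h0 : ∀ i C, Tendsto (fun n : ℕ => (ξ n 0 i C : ℝ) / n) atTop (𝓝 (x₀ i C)))
    {y : ℝ → Cell m → UserClass K → ℝ}
    (hy : ∀ t, 0 ≤ t → ∀ i C, Tendsto (fun n => rescaledPath ξ n t i C) 𝒰 (𝓝 (y t i C))) :
    y 0 = x₀ := by
  funext i C
  refine tendsto_nhds_unique (hy 0 le_rfl i C) ?_
  simpa [rescaledPath] using (h0 i C).mono_left h𝒰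

lemma exists_isWeakFluidSolution (ha : ∀ i C, HasUnitRate (a i C))
    (hd : ∀ i C, HasUnitRate (d i C)) (hξ : ∀ n, M.IsDominatingPath a d (ξ n))
    (h0 : ∀ i C, Tendsto (fun n : ℕ => (ξ n 0 i C : ℝ) / n) atTop (𝓝 (x₀ i C))) :
    ∃ x, M.IsWeakFluidSolution x ∧ x 0 = x₀ := by
  have h𝒰 : (Ultrafilter.of (atTop : Filter ℕ) : Filter ℕ) ≤ atTop := Ultrafilter.of_le _
  obtain ⟨x, hx⟩ := exists_ultrafilter_limit ha hd hξ h0 _ h𝒰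
  exact ⟨x, isWeakFluidSolution_of_tendsto ha hd hξ h𝒰 hx, limit_zero_eq h𝒰 h0 hx⟩

/-- By uniqueness, all ultrafilters give the same limit. -/
lemma tendsto_rescaledPath (ha : ∀ i C, HasUnitRate (a i C))
    (hd : ∀ i C, HasUnitRate (d i C)) (hξ : ∀ n, M.IsDominatingPath a d (ξ n))
    (h0 : ∀ i C, Tendsto (fun n : ℕ => (ξ n 0 i C : ℝ) / n) atTop (𝓝 (x₀ i C)))
    (hne : x₀ ≠ 0) (hp : ∀ i C, 0 < x₀ i C ∨ 0 < M.p C)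
    {x : ℝ → Cell m → UserClass K → ℝ} (hx : M.IsWeakFluidSolution x) (hx0 : x 0 = x₀)
    {t : ℝ} (ht : 0 ≤ t) (i : Cell m) (C : UserClass K) :
    Tendsto (fun n => rescaledPath ξ n t i C) atTop (𝓝 (x t i C)) := by
  rw [tendsto_iff_ultrafilter]
  intro 𝒰 h𝒰
  obtain ⟨y, hy⟩ := exists_ultrafilter_limit ha hd hξ h0 _ h𝒰
  have hyw := isWeakFluidSolution_of_tendsto ha hd hξ h𝒰 hy
  have hy0 := limit_zero_eq h𝒰 h0 hy
  subst hx0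
  rw [← hx.eq_of_initial_eq hyw hne hp hy0 ht]
  exact hy t ht i C

lemma tendstoUniformlyOn_rescaledPath (ha : ∀ i C, HasUnitRate (a i C))
    (hd : ∀ i C, HasUnitRate (d i C)) (hξ : ∀ n, M.IsDominatingPath a d (ξ n))
    (h0 : ∀ i C, Tendsto (fun n : ℕ => (ξ n 0 i C : ℝ) / n) atTop (𝓝 (x₀ i C)))
    (hne : x₀ ≠ 0) (hp : ∀ i C, 0 < x₀ i C ∨ 0 < M.p C)
    {x : ℝ → Cell m → UserClass K → ℝ} (hx : M.IsWeakFluidSolution x) (hx0 : x 0 = x₀) (T : ℝ) :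
    TendstoUniformlyOn (rescaledPath ξ) x atTop (Set.Icc 0 T) := by
  rw [← tendstoLocallyUniformlyOn_iff_tendstoUniformlyOn_of_compact isCompact_Icc,
    Metric.tendstoLocallyUniformlyOn_iff]
  intro ε hε t ht
  set Λ : ℝ := ∑ U : UserClass K, M.fluidLipschitz U + 1
  have hΛ : ∀ U, M.fluidLipschitz U ≤ Λ := fun U =>
    (Finset.single_le_sum (f := M.fluidLipschitz) (fun U _ => M.fluidLipschitz_nonneg U)
      (Finset.mem_univ U)).trans (le_add_of_nonneg_right zero_le_one)
  have hΛ0 : 0 < Λ := add_pos_of_nonneg_of_pos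
    (Finset.sum_nonneg fun U _ => M.fluidLipschitz_nonneg U) one_pos
  have hcx : ∀ᶠ u in 𝓝[Set.Icc 0 T] t, ∀ i C, |x u i C - x t i C| < ε / 4 :=
    eventually_all.2 fun i => eventually_all.2 fun C =>
      (((hx.continuousOn i C) t ht.1).mono_left (nhdsWithin_mono _ fun u hu => hu.1)).eventually
        (Metric.ball_mem_nhds _ (by positivity))
  refine ⟨_, inter_mem (inter_mem hcx self_mem_nhdsWithin)
    (mem_nhdsWithin_of_mem_nhds (Metric.ball_mem_nhds t (ε := ε / 4 / Λ) (by positivity))), ?_⟩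
  have hxt : ∀ᶠ n in atTop, ∀ i C, |rescaledPath ξ n t i C - x t i C| < ε / 4 :=
    eventually_all.2 fun i => eventually_all.2 fun C =>
      (tendsto_rescaledPath ha hd hξ h0 hne hp hx hx0 ht.1 i C).eventually
        (Metric.ball_mem_nhds _ (by positivity))
  filter_upwards [hxt, eventually_equicontinuous ha hd hξ T (η := ε / 4) (by positivity)]
    with n h1 h2 u hu
  obtain ⟨⟨hu1, huT⟩, hu2⟩ := hu
  rw [Metric.mem_ball, Real.dist_eq, lt_div_iff₀ hΛ0] at hu2
  rw [dist_pi_lt_iff hε]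
  intro i
  rw [dist_pi_lt_iff hε]
  intro C
  have e1 := h1 i C
  have e2 := h2 t ht u huT i C
  have e3 := hu1 i C
  have e4 : M.fluidLipschitz C * |u - t| ≤ |u - t| * Λ := by
    rw [mul_comm]
    exact mul_le_mul_of_nonneg_left (hΛ C) (abs_nonneg _)
  rw [Real.dist_eq]
  rw [abs_lt] at e1 e3 ⊢
  rw [abs_le] at e2
  constructor <;> linarith [e1.1, e1.2, e2.1, e2.2, e3.1, e3.2]

end Network

/-! ### The law of large numbers for Poisson processes -/

lemma hasUnitRate_of_tendsto {z : ℝ≥0 → ℕ} (hz : Monotone z)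
    (h : Tendsto (fun n : ℕ => (z n : ℝ) / n) atTop (𝓝 1)) : HasUnitRate z := by
  intro S η hη
  set δ : ℝ := η / (2 * (|S| + 1)) with hδ
  have hS : 0 < |S| + 1 := by positivity
  have hδ0 : 0 < δ := by positivity
  obtain ⟨k₀, hk₀⟩ := eventually_atTop.1 (Metric.tendsto_nhds.1 h δ hδ0)
  -- The constant `c` absorbs all integers below `k₀`. Monotonicity then interpolates between
  -- integers, at a cost `δ + c + 1` that is negligible after division by `n`.
  set c : ℝ := (z k₀ : ℝ) + k₀
  have hbound : ∀ k : ℕ, |(z k : ℝ) - k| ≤ δ * k + c := by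
    intro k
    rcases le_total k₀ k with hk | hk
    · have hc : 0 ≤ c := by positivity
      rcases Nat.eq_zero_or_pos k with rfl | hk0
      · have : k₀ = 0 := by omega
        simp [c, this]
      have hk0 : (0 : ℝ) < k := by exact_mod_cast hk0
      have h1 := (hk₀ k hk).le
      rw [Real.dist_eq, div_sub_one hk0.ne', abs_div, abs_of_pos hk0, div_le_iff₀ hk0] at h1
      linarith
    · have h1 : (z k : ℝ) ≤ z k₀ := by exact_mod_cast hz (by exact_mod_cast hk)
      have h2 : (k : ℝ) ≤ k₀ := by exact_mod_cast hk
      have h3 : (0 : ℝ) ≤ z k := by positivity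
      have h4 : (0 : ℝ) ≤ k := by positivity
      have h5 : 0 ≤ δ * k := by positivity
      rw [abs_le]
      constructor <;> simp only [c] <;> linarith
  have hlim : Tendsto (fun n : ℕ => (δ + c + 1) / (n : ℝ)) atTop (𝓝 0) :=
    tendsto_const_div_atTop_nhds_zero_nat _
  filter_upwards [hlim.eventually_lt_const (half_pos hη), eventually_gt_atTop 0] with n hn1 hn s hs
  have hn : (0 : ℝ) < n := by exact_mod_cast hn
  have hns : 0 ≤ (n : ℝ) * s := mul_nonneg hn.le hs.1
  set k := ⌊(n : ℝ) * s⌋₊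
  have hk1 : (k : ℝ) ≤ n * s := Nat.floor_le hns
  have hk2 : (n : ℝ) * s < k + 1 := Nat.lt_floor_add_one _
  have hz1 : (z k : ℝ) ≤ z (Real.toNNReal (n * s)) := by
    have : (k : ℝ≥0) ≤ Real.toNNReal (n * s) := by
      rw [Real.le_toNNReal_iff_coe_le hns]; exact_mod_cast hk1
    exact_mod_cast hz this
  have hz2 : (z (Real.toNNReal (n * s)) : ℝ) ≤ z ((k + 1 : ℕ) : ℝ≥0) := by
    have : Real.toNNReal (n * s) ≤ ((k + 1 : ℕ) : ℝ≥0) := by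
      rw [Real.toNNReal_le_iff_le_coe]; push_cast; exact hk2.le
    exact_mod_cast hz this
  have hb1 := abs_le.1 (hbound k)
  have hb2 := abs_le.1 (hbound (k + 1))
  push_cast at hb2 hz2
  have hδk := mul_le_mul_of_nonneg_left hk1 hδ0.le
  have hmain : |(z (Real.toNNReal (n * s)) : ℝ) - n * s| ≤ δ * (n * s) + (δ + c + 1) := by
    rw [abs_le]
    constructor <;> linarith [hb1.1, hb1.2, hb2.1, hb2.2]
  have hδS : δ * s ≤ η / 2 := by
    have h1 : s ≤ |S| + 1 := hs.2.trans ((le_abs_self S).trans (by linarith))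
    have h2 := mul_le_mul_of_nonneg_left h1 hδ0.le
    have h3 : δ * (|S| + 1) = η / 2 := by rw [hδ]; field_simp
    linarith
  have hdiv : |(z (Real.toNNReal (n * s)) : ℝ) / n - s|
      = |(z (Real.toNNReal (n * s)) : ℝ) - n * s| / n := by
    rw [← abs_of_pos hn, ← abs_div, abs_of_pos hn, sub_div, mul_div_cancel_left₀ _ hn.ne']
  rw [hdiv, div_le_iff₀ hn]
  rw [div_lt_iff₀ hn] at hn1
  nlinarith

/-- Cancelling `n` against `n!` and shifting the index leaves `r` times the total mass. -/
lemma hasSum_mul_poissonMeasure (r : ℝ≥0) :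
    HasSum (fun n : ℕ => Real.exp (-r) * (r : ℝ) ^ n / (n.factorial : ℝ) * n) r := by
  have h := (hasSum_one_poissonMeasure r).mul_left (r : ℝ)
  rw [mul_one] at h
  have h2 := (hasSum_nat_add_iff' (f := fun n : ℕ =>
    Real.exp (-r) * (r : ℝ) ^ n / (n.factorial : ℝ) * n) (g := (r : ℝ)) 1).1 ?_
  · exact h2
  · simp only [Finset.range_one, Finset.sum_singleton, Nat.cast_zero, mul_zero, sub_zero]
    refine (congrArg (HasSum · (r : ℝ)) (funext fun n => ?_)).mp h
    rw [Nat.factorial_succ]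
    push_cast
    field_simp
    ring

lemma integrable_natCast_poissonMeasure (r : ℝ≥0) :
    Integrable (fun n : ℕ => (n : ℝ)) (poissonMeasure r) := by
  rw [integrable_poissonMeasure_iff]
  simpa using (hasSum_mul_poissonMeasure r).summable

lemma integral_natCast_poissonMeasure (r : ℝ≥0) :
    ∫ n : ℕ, (n : ℝ) ∂(poissonMeasure r) = r := by
  rw [integral_poissonMeasure]
  simpa using (hasSum_mul_poissonMeasure r).tsum_eq

namespace IsUnitPoissonProcess

variable {Ω : Type*} [MeasurableSpace Ω] {Z : ℝ≥0 → Ω → ℕ} {P : Measure Ω}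

lemma ae_tendsto_div (hZ : IsUnitPoissonProcess Z P) :
    ∀ᵐ ω ∂P, Tendsto (fun n : ℕ => (Z n ω : ℝ) / n) atTop (𝓝 1) := by
  set D : ℕ → Ω → ℕ := fun k ω => Z ((k + 1 : ℕ) : ℝ≥0) ω - Z (k : ℝ≥0) ω
  have hcast : Measurable (Nat.cast : ℕ → ℝ) := measurable_of_countable _
  have hD : ∀ k, Measurable (D k) := fun k => (hZ.measurable _).sub (hZ.measurable _)
  have hlaw : ∀ k, P.map (D k) = poissonMeasure 1 := fun k => by
    have := hZ.law (k : ℝ≥0) ((k + 1 : ℕ) : ℝ≥0) (by exact_mod_cast Nat.le_succ k)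
    rwa [Nat.cast_succ, add_tsub_cancel_left, ← Nat.cast_succ] at this
  have hindep : iIndepFun D P :=
    hZ.indepIncrements.nat (t := fun k : ℕ => (k : ℝ≥0)) Nat.mono_cast
  have hint : Integrable (fun ω => (D 0 ω : ℝ)) P := by
    have := integrable_natCast_poissonMeasure 1
    rw [← hlaw 0] at this
    exact this.comp_measurable (hD 0)
  have hmean : ∫ ω, (D 0 ω : ℝ) ∂P = 1 := by
    have := integral_natCast_poissonMeasure 1
    rw [← hlaw 0, integral_map (hD 0).aemeasurable hcast.aestronglyMeasurable] at this
    simpa using this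
  have hslln := strong_law_ae_real (fun k ω => (D k ω : ℝ)) hint
    (fun i j hij => (hindep.indepFun hij).comp hcast hcast)
    (fun k => (IdentDistrib.mk (hD k).aemeasurable (hD 0).aemeasurable
      (by rw [hlaw, hlaw])).comp hcast)
  rw [hmean] at hslln
  filter_upwards [hslln] with ω hω
  refine hω.congr fun n => ?_
  congr 1
  have hsum : ∑ k ∈ Finset.range n, D k ω = Z n ω := by
    induction n with
    | zero => simp [hZ.zero]
    | succ n ih =>
      rw [Finset.sum_range_succ, ih]
      exact Nat.add_sub_of_le (hZ.monotone ω (by exact_mod_cast Nat.le_succ n))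
  rw [← hsum, Nat.cast_sum]

lemma ae_hasUnitRate (hZ : IsUnitPoissonProcess Z P) :
    ∀ᵐ ω ∂P, HasUnitRate fun t => Z t ω := by
  filter_upwards [hZ.ae_tendsto_div] with ω hω using hasUnitRate_of_tendsto (hZ.monotone ω) hω

end IsUnitPoissonProcess

/-! ### The fluid limit theorem -/

theorem mainTheorem5 {K m : ℕ} (M : Network K m)
    {Ω : Type*} [MeasurableSpace Ω] (P : Measure Ω) [IsProbabilityMeasure P]
    (A N : Cell m → UserClass K → ℝ≥0 → Ω → ℕ)
    (hA : ∀ i C, IsUnitPoissonProcess (A i C) P)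
    (hN : ∀ i C, IsUnitPoissonProcess (N i C) P)
    (hAN : iIndepFun
      (Sum.elim (fun (q : Cell m × UserClass K) (ω : Ω) (t : ℝ≥0) => A q.1 q.2 t ω)
        (fun (q : Cell m × UserClass K) (ω : Ω) (t : ℝ≥0) => N q.1 q.2 t ω)) P)
    (X : ℕ → Ω → ℝ → Cell m → UserClass K → ℕ)
    (hX : ∀ n, ∀ᵐ ω ∂P,
      M.IsDominatingPath (fun i C t => A i C t ω) (fun i C t => N i C t ω) (X n ω))
    (x₀ : Cell m → UserClass K → ℝ)
    (hx₀ : x₀ ≠ 0)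
    (hpos : ∀ i C, 0 < x₀ i C ∨ 0 < M.p C)
    (hinit : ∀ᵐ ω ∂P, ∀ i C,
      Tendsto (fun n : ℕ => (X n ω 0 i C : ℝ) / n) atTop (𝓝 (x₀ i C))) :
    ∃ x : ℝ → Cell m → UserClass K → ℝ,
      M.IsFluidSolution x₀ x ∧
      (∀ y, M.IsFluidSolution x₀ y → ∀ t, 0 ≤ t → y t = x t) ∧
      ∀ᵐ ω ∂P, ∀ T : ℝ, 0 < T →
        TendstoUniformlyOn (fun (n : ℕ) (t : ℝ) i C => (X n ω (n * t) i C : ℝ) / n)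
          x atTop (Set.Icc 0 T) := by
  have hA' : ∀ᵐ ω ∂P, ∀ i C, HasUnitRate fun t => A i C t ω :=
    ae_all_iff.2 fun i => ae_all_iff.2 fun C => (hA i C).ae_hasUnitRate
  have hN' : ∀ᵐ ω ∂P, ∀ i C, HasUnitRate fun t => N i C t ω :=
    ae_all_iff.2 fun i => ae_all_iff.2 fun C => (hN i C).ae_hasUnitRate
  have hall := hA'.and (hN'.and ((ae_all_iff.2 hX).and hinit))
  -- A single good outcome produces the deterministic solution, to which uniqueness ties almost
  -- every other outcome.
  obtain ⟨ω, ha, hd, hξ, h0⟩ := hall.exists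
  obtain ⟨x, hx, hx0⟩ := Network.exists_isWeakFluidSolution ha hd hξ h0
  refine ⟨x, hx.isFluidSolution hx0 hx₀ hpos, fun y hy t ht => ?_, ?_⟩
  · subst hx0
    exact hx.eq_of_initial_eq hy.isWeakFluidSolution hx₀ hpos hy.initial ht
  · filter_upwards [hall] with ω ⟨ha, hd, hξ, h0⟩ T hT
    exact Network.tendstoUniformlyOn_rescaledPath (ξ := fun n => X n ω) ha hd hξ h0 hx₀ hpos
      hx hx0 T
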